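/- Let $(\Omega,\mathcal F,(\mathcal F_t)_{t\ge 0},(X_t)_{t\ge 0},(\mathbb P_x)_{x\in\mathsf X})$ be a time-homogeneous strong Markov family with càdlàg paths on a locally compact separable metric space $\mathsf X$ with its Borel $\sigma$-field, where $\mathbb P_x(X_0=x)=1$, and let $P^t(x,A)=\mathbb P_x(X_t\in A)$. Terminology. A non-zero $\sigma$-finite measure $\phi$ on $\mathsf X$ is an irreducibility measure if $\phi(A)>0$ implies $\mathbb E_x\big[\int_0^\infty \mathbf 1_A(X_s)\,ds\big]>0$ for all $x$; it is maximal if every irreducibility measure is absolutely continuous with respect to it. The process is $\psi$-irreducible if an irreducibility measure exists. A measurable set $B$ is accessible if $\psi(B)>0$ for some maximal irreducibility measure $\psi$. A measurable set $C$ is petite if there are a probability measure $a$ on $[0,\infty)$ and a non-zero $\sigma$-finite measure $\nu$ on $\mathsf X$ with $\int_0^\infty P^t(x,A)\,a(dt)\ge\nu(A)$ for all $x\in C$ and all measurable $A$. Let $\Lambda_0$ be the set of measurable nondecreasing $r_0:[0,\infty)\to[2,\infty)$ such that $t\mapsto \log r_0(t)/t$ is nonincreasing on $(0,\infty)$ and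 tends to $0$ as $t\to\infty$. A measurable $r:[0,\infty)\to(0,\infty)$ is a subgeometric rate function if for some $r_0\in\Lambda_0$, $$0<\liminf_{t\to\infty} r(t)/r_0(t)\le\limsup_{t\to\infty} r(t)/r_0(t)<\infty .$$ For measurable $B$ and $\delta\ge 0$ put $\tau_B(\delta)=\inf\{t\ge\delta: X_t\in B\}$ (with $\inf\emptyset=\infty$) and $$G_B(x,f,r;\delta)=\mathbb E_x\Big[\int_0^{\tau_B(\delta)} r(s)f(X_s)\,ds\Big]\in[0,\infty].$$ A measurable set $C$ is $(f,r)$-regular if $\sup_{x\in C}G_B(x,f,r;\delta)<\infty$ for all $\delta>0$ and all accessible $B$. Proposition. Let $f:\mathsf X\to[1,\infty)$ be measurable and let $r$ be a subgeometric rate function that is bounded, and bounded away from $0$, on every interval $[0,T]$. Assume that the process is $\psi$-irreducible and that $\sup_{x\in C}G_C(x,f,r;\delta)<\infty$ for some $\delta>0$ and some closed petite set $C$. Then: 1. $\sup_{x\in C}G_C(x,f,r;\delta')<\infty$ for every $\delta'>0$; 2. for every accessible set $B$ and every $t\ge 0$ there is a constant $c_{B,t}<\infty$ such that $G_B(x,f,r;t)\le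 c_{B,t}\,G_C(x,f,r;\delta)$ for all $x\in\mathsf X$; 3. $C$ is $(f,r)$-regular. -/

import Mathlib

open MeasureTheory ProbabilityTheory Filter Topology
open scoped NNReal ENNReal

/-- A time-homogeneous strong Markov family with càdlàg paths on the state space `E`: a process
`X` on `Ω`, adapted to a filtration `ℱ`, with a probability measure `P x` for each starting
point `x`.  The filtration need be neither right-continuous nor complete. -/
structure StrongMarkovFamily (E Ω : Type*) [TopologicalSpace E] [MeasurableSpace E]
    [mΩ : MeasurableSpace Ω] where
  /-- The filtration. -/
  ℱ : Filtration ℝ≥0 mΩ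
  /-- The process. -/
  X : ℝ≥0 → Ω → E
  /-- The law under which the process starts from a given point. -/
  P : E → Measure Ω
  isProbabilityMeasure : ∀ x, IsProbabilityMeasure (P x)
  adapted : ∀ t, Measurable[ℱ t] (X t)
  right_continuous : ∀ ω t, ContinuousWithinAt (fun s => X s ω) (Set.Ici t) t
  left_limits : ∀ ω t, ∃ l, Tendsto (fun s => X s ω) (𝓝[<] t) (𝓝 l)
  start : ∀ x, ∀ᵐ ω ∂(P x), X 0 ω = x
  /-- The law of the path depends measurably on the starting point. -/
  measurable_law : ∀ A : Set (ℝ≥0 → E), MeasurableSet A →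
    Measurable fun x => P x {ω | (fun t => X t ω) ∈ A}
  /-- Strong Markov property: for every stopping time `τ`, on `{τ < ∞}` the conditional law of
  `(X (τ + t))_{t ≥ 0}` given `ℱ_τ` is the law of `(X t)_{t ≥ 0}` under `P (X τ)`. -/
  strong_markov : ∀ (x : E) (τ : Ω → WithTop ℝ≥0) (hτ : IsStoppingTime ℱ τ)
    (F : Set Ω), MeasurableSet[hτ.measurableSpace] F →
    ∀ A : Set (ℝ≥0 → E), MeasurableSet A →
      P x (F ∩ {ω | τ ω < ⊤} ∩ {ω | (fun t => X ((τ ω).untopD 0 + t) ω) ∈ A}) =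
        ∫⁻ ω in F ∩ {ω | τ ω < ⊤},
          P (X ((τ ω).untopD 0) ω) {ω' | (fun t => X t ω') ∈ A} ∂(P x)

/-- The class `Λ₀`: measurable nondecreasing `r : [0,∞) → [2,∞)` such that `log r(t) / t`
decreases to `0` as `t → ∞`. -/
structure IsLambdaZero (r : ℝ≥0 → ℝ) : Prop where
  measurable : Measurable r
  monotone : Monotone r
  two_le : ∀ t, 2 ≤ r t
  antitone : AntitoneOn (fun t : ℝ≥0 => Real.log (r t) / t) (Set.Ioi 0)
  tendsto : Tendsto (fun t : ℝ≥0 => Real.log (r t) / t) atTop (𝓝 0)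

/-- The class `Λ` of subgeometric rate functions: positive measurable functions that are
asymptotically of the same order as an element of `Λ₀`. -/
def IsSubgeometricRate (r : ℝ≥0 → ℝ) : Prop :=
  Measurable r ∧ (∀ t, 0 < r t) ∧ ∃ r₀, IsLambdaZero r₀ ∧
    0 < liminf (fun t => ENNReal.ofReal (r t / r₀ t)) atTop ∧
    limsup (fun t => ENNReal.ofReal (r t / r₀ t)) atTop < ⊤

namespace StrongMarkovFamily

variable {E Ω : Type*} [TopologicalSpace E] [MeasurableSpace E] [MeasurableSpace Ω]

/-- `P^t(x, A)`, the transition function. -/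
noncomputable def transition (M : StrongMarkovFamily E Ω) (t : ℝ≥0) (x : E) (A : Set E) : ℝ≥0∞ :=
  M.P x {ω | M.X t ω ∈ A}

/-- `E_x [∫₀^∞ 1_A(X_s) ds]`. -/
noncomputable def occupation (M : StrongMarkovFamily E Ω) (x : E) (A : Set E) : ℝ≥0∞ :=
  ∫⁻ ω, (∫⁻ s in Set.Ici (0 : ℝ), A.indicator 1 (M.X s.toNNReal ω)) ∂(M.P x)

/-- `φ` is a (non-trivial, σ-finite) irreducibility measure of the process. -/
structure IsIrreducibilityMeasure (M : StrongMarkovFamily E Ω) (φ : Measure E) : Prop where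
  sigmaFinite : SigmaFinite φ
  ne_zero : φ ≠ 0
  occupation_pos : ∀ A, MeasurableSet A → 0 < φ A → ∀ x, 0 < M.occupation x A

/-- `ψ` is an irreducibility measure that dominates every irreducibility measure. -/
def IsMaximalIrreducibilityMeasure (M : StrongMarkovFamily E Ω) (ψ : Measure E) : Prop :=
  M.IsIrreducibilityMeasure ψ ∧ ∀ φ, M.IsIrreducibilityMeasure φ → φ ≪ ψ

/-- `B` is a measurable set charged by some maximal irreducibility measure. -/
def IsAccessible (M : StrongMarkovFamily E Ω) (B : Set E) : Prop :=
  MeasurableSet B ∧ ∃ ψ, M.IsMaximalIrreducibilityMeasure ψ ∧ 0 < ψ B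

/-- `C` is petite: some sampled kernel dominates a non-trivial measure `ν` on `C`. -/
def IsPetite (M : StrongMarkovFamily E Ω) (C : Set E) : Prop :=
  MeasurableSet C ∧ ∃ (a : Measure ℝ≥0) (ν : Measure E), IsProbabilityMeasure a ∧
    SigmaFinite ν ∧ ν ≠ 0 ∧
    ∀ x ∈ C, ∀ A, MeasurableSet A → ν A ≤ ∫⁻ t, M.transition t x A ∂a

/-- `G_B(x, f, r; δ) = E_x [∫₀^{τ_B(δ)} r(s) f(X_s) ds]`, where
`τ_B(δ) = inf {t ≥ δ | X_t ∈ B}` (with `inf ∅ = ∞`). -/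
noncomputable def modulatedMoment (M : StrongMarkovFamily E Ω) (B : Set E) (f : E → ℝ)
    (r : ℝ≥0 → ℝ) (δ : ℝ≥0) (x : E) : ℝ≥0∞ :=
  ∫⁻ ω, (∫⁻ s in {s : ℝ | 0 ≤ s ∧ (s.toNNReal : WithTop ℝ≥0) ≤ hittingAfter M.X B δ ω},
    ENNReal.ofReal (r s.toNNReal) * ENNReal.ofReal (f (M.X s.toNNReal ω))) ∂(M.P x)

/-- `C` is `(f, r)`-regular. -/
def IsRegular (M : StrongMarkovFamily E Ω) (f : E → ℝ) (r : ℝ≥0 → ℝ) (C : Set E) : Prop :=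
  MeasurableSet C ∧ ∀ δ : ℝ≥0, 0 < δ → ∀ B, M.IsAccessible B →
    (⨆ x ∈ C, M.modulatedMoment B f r δ x) < ⊤

end StrongMarkovFamily

/-!
The proof follows the regeneration argument: from `C`, the process makes cycles between successive
visits to `C` that are at least `h` apart, and during each cycle it visits an accessible set `B`
with a probability bounded away from zero.  The modulated moment up to the first visit to `B` is
thus a sum over cycles in which the `k`-th term contains the probability that `k` trials have
failed, weighted by the rate at the start of the cycle.

*Rate.*  Up to constants the rate is a submultiplicative weight `V` (`IsTameWeight`).  Because
`log V(t) / t` decreases to `0`, one has `V(s + u) / V(s) → 1` as `s → ∞` for bounded `u`, and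
`V(t)` is negligible compared with `∫₀^t V`.  Hence over late cycles the mean of the weight is
multiplied by a factor close to `1`, and by a factor `κ < 1` on the event that `B` is missed
(`HitsAfter.setLIntegral_weight_le_of_slow`).  The earlier cycles, finite in number, cost a constant
factor each, and the series converges (`tsum_le_of_eventually_contracting`).

*Success probability.*  Petiteness of `C`, together with the Chapman–Kolmogorov equation, gives a
time `L` such that the process started in `C` spends a positive time in `B` before `L`, with
probability bounded below (`IsPetite.exists_law_le`).  By inner regularity `B` may be taken closed.

*Measurability.*  The filtration is neither complete nor right-continuous, so the first visit to a
closed set need not be a stopping time, nor even measurable, and modulated moments are lower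
integrals.  For each fixed law, however, a maximal stopping time among those that precede all
visits to a closed set is almost surely such a visit (`exists_isStoppingTime_hitting`).  The cycles
are built from these stopping times.  Applied to the law of the path after a stopping time, the
same result yields a measurable functional of the path below the hitting time and almost surely
equal to it, to which the strong Markov property applies (`HitsAfter.exists_isPathTime`); its
integral from a point of `C` is bounded by the modulated moment, as this is a lower integral.
-/

/-! ### Lebesgue measure on the half-line -/

/-- Lebesgue measure on `[0, ∞)`, as a measure on `ℝ≥0`. -/
noncomputable def timeMeasure : Measure ℝ≥0 :=
  (volume.restrict (Set.Ici (0 : ℝ))).map Real.toNNReal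

instance : SFinite timeMeasure := by unfold timeMeasure; infer_instance

theorem lintegral_timeMeasure {G : ℝ≥0 → ℝ≥0∞} (hG : Measurable G) :
    ∫⁻ u, G u ∂timeMeasure = ∫⁻ s in Set.Ici (0 : ℝ), G s.toNNReal :=
  lintegral_map hG measurable_real_toNNReal

theorem measurableSet_coe_le (τ : WithTop ℝ≥0) : MeasurableSet {u : ℝ≥0 | (u : WithTop ℝ≥0) ≤ τ} :=
  measurableSet_le WithTop.measurable_coe measurable_const

theorem setLIntegral_timeMeasure {G : ℝ≥0 → ℝ≥0∞} (hG : Measurable G) {S : Set ℝ≥0}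
    (hS : MeasurableSet S) :
    ∫⁻ u in S, G u ∂timeMeasure = ∫⁻ s in {s : ℝ | 0 ≤ s ∧ s.toNNReal ∈ S}, G s.toNNReal := by
  unfold timeMeasure
  rw [setLIntegral_map hS hG measurable_real_toNNReal,
    Measure.restrict_restrict (measurable_real_toNNReal hS)]
  congr 2
  ext s
  simp [and_comm]

theorem lintegral_timeMeasure_shift {G : ℝ≥0 → ℝ≥0∞} (hG : Measurable G) (a : ℝ≥0) :
    ∫⁻ u in Set.Ici a, G u ∂timeMeasure = ∫⁻ u, G (a + u) ∂timeMeasure := by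
  rw [setLIntegral_timeMeasure hG measurableSet_Ici,
    lintegral_timeMeasure (G := fun u => G (a + u))
      (hG.comp (measurable_const.add measurable_id))]
  rw [← lintegral_indicator measurableSet_Ici, ← lintegral_indicator
    (by exact measurableSet_Ici.inter (measurable_real_toNNReal measurableSet_Ici)),
    ← lintegral_add_right_eq_self _ (a : ℝ)]
  refine lintegral_congr fun s => ?_
  simp only [Set.indicator_apply, Set.mem_ofPred_eq, Set.mem_Ici]
  by_cases hs : 0 ≤ s
  · have h1 : (s + a).toNNReal = a + s.toNNReal := by
      refine (Real.toNNReal_add hs a.2).trans ?_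
      rw [add_comm]
      exact congrArg (· + _) Real.toNNReal_coe
    rw [if_pos hs, if_pos ⟨by positivity, by rw [h1]; exact le_self_add⟩, h1]
  · rw [if_neg hs, if_neg]
    rintro ⟨h0, h1⟩
    rw [Real.le_toNNReal_iff_coe_le h0] at h1
    linarith

theorem setLIntegral_timeMeasure_shift {G : ℝ≥0 → ℝ≥0∞} (hG : Measurable G) (a : ℝ≥0)
    {S : Set ℝ≥0} (hS : MeasurableSet S) (hSa : S ⊆ Set.Ici a) :
    ∫⁻ u in S, G u ∂timeMeasure = ∫⁻ u in {u | a + u ∈ S}, G (a + u) ∂timeMeasure := by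
  have hm : Measurable fun u : ℝ≥0 => a + u := measurable_const.add measurable_id
  rw [← lintegral_indicator (show MeasurableSet {u | a + u ∈ S} from hm hS),
    show (fun u => ({u | a + u ∈ S} : Set ℝ≥0).indicator (fun u => G (a + u)) u) =
      fun u => S.indicator G (a + u) from rfl,
    ← lintegral_timeMeasure_shift (hG.indicator hS),
    setLIntegral_indicator hS, Set.inter_eq_left.2 hSa]

theorem timeMeasure_Icc (a b : ℝ≥0) : timeMeasure (Set.Icc a b) = (b - a : ℝ≥0) := by
  unfold timeMeasure
  rw [Measure.map_apply measurable_real_toNNReal measurableSet_Icc,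
    Measure.restrict_apply (measurable_real_toNNReal measurableSet_Icc),
    show Real.toNNReal ⁻¹' Set.Icc a b ∩ Set.Ici (0 : ℝ) = Set.Icc (a : ℝ) b from ?_,
    Real.volume_Icc]
  · rw [ENNReal.ofReal, ENNReal.coe_inj]
    apply NNReal.eq
    rw [Real.coe_toNNReal', NNReal.coe_sub_def]
  · ext s
    simp only [Set.mem_inter_iff, Set.mem_preimage, Set.mem_Icc, Set.mem_Ici]
    constructor
    · rintro ⟨⟨h1, h2⟩, h0⟩
      exact ⟨(Real.le_toNNReal_iff_coe_le h0).1 h1, Real.toNNReal_le_iff_le_coe.1 h2⟩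
    · rintro ⟨h1, h2⟩
      have h0 : 0 ≤ s := a.2.trans h1
      exact ⟨⟨(Real.le_toNNReal_iff_coe_le h0).2 h1, Real.toNNReal_le_iff_le_coe.2 h2⟩, h0⟩

/-! ### Rate functions -/

namespace IsLambdaZero

variable {r : ℝ≥0 → ℝ}

theorem log_pos (h : IsLambdaZero r) (t : ℝ≥0) : 0 < Real.log (r t) :=
  Real.log_pos (by linarith [h.two_le t])

theorem pos (h : IsLambdaZero r) (t : ℝ≥0) : 0 < r t := by linarith [h.two_le t]

/-- Since `log r(t) / t` is nonincreasing, `log r(s + t) ≤ (1 + t / s) log r(s)`. -/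
theorem add_le_mul_exp (h : IsLambdaZero r) {s : ℝ≥0} (hs : 0 < s) (t : ℝ≥0) :
    r (s + t) ≤ r s * Real.exp (t * (Real.log (r s) / s)) := by
  have h1 : Real.log (r (s + t)) / ((s + t : ℝ≥0) : ℝ) ≤ Real.log (r s) / s :=
    h.antitone (Set.mem_Ioi.2 hs) (Set.mem_Ioi.2 (by positivity)) le_self_add
  have hs' : (0 : ℝ) < s := hs
  have hst : (0 : ℝ) < ((s + t : ℝ≥0) : ℝ) := by push_cast; positivity
  rw [div_le_iff₀ hst] at h1
  rw [← Real.log_le_log_iff (h.pos _) (by have := h.pos s; positivity),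
    Real.log_mul (h.pos s).ne' (Real.exp_ne_zero _), Real.log_exp]
  refine h1.trans (le_of_eq ?_)
  push_cast
  field_simp

theorem add_le_mul (h : IsLambdaZero r) (s t : ℝ≥0) : r (s + t) ≤ r s * r t := by
  have key : ∀ s t : ℝ≥0, 0 < s → s ≤ t → r (t + s) ≤ r t * r s := fun s t hs hst => by
    refine (h.add_le_mul_exp (hs.trans_le hst) s).trans ?_
    refine mul_le_mul_of_nonneg_left ?_ (h.pos t).le
    rw [← Real.le_log_iff_exp_le (h.pos s)]
    have h1 : Real.log (r t) / t ≤ Real.log (r s) / s :=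
      h.antitone (Set.mem_Ioi.2 hs) (Set.mem_Ioi.2 (hs.trans_le hst)) hst
    have hs' : (0 : ℝ) < s := hs
    calc (s : ℝ) * (Real.log (r t) / t) ≤ s * (Real.log (r s) / s) := by gcongr
      _ = Real.log (r s) := by field_simp
  rcases eq_or_lt_of_le (zero_le (a := s)) with rfl | hs
  · rw [zero_add]; nlinarith [h.two_le 0, h.pos t]
  rcases eq_or_lt_of_le (zero_le (a := t)) with rfl | ht
  · rw [add_zero]; nlinarith [h.two_le 0, h.pos s]
  rcases le_total s t with hst | hst
  · rw [add_comm, mul_comm]; exact key s t hs hst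
  · exact key t s ht hst

theorem exists_add_le_mul (h : IsLambdaZero r) (T : ℝ≥0) {θ : ℝ} (hθ : 1 < θ) :
    ∃ S : ℝ≥0, ∀ s ≥ S, ∀ u ≤ T, r (s + u) ≤ θ * r s := by
  have h1 : Tendsto (fun s : ℝ≥0 => (T : ℝ) * (Real.log (r s) / s)) atTop (𝓝 0) := by
    simpa using h.tendsto.const_mul (T : ℝ)
  have h2 := h1.eventually (gt_mem_nhds (Real.log_pos hθ))
  obtain ⟨S, hS⟩ := (h2.and (eventually_gt_atTop 0)).exists_forall_of_atTop
  refine ⟨S, fun s hs u hu => ?_⟩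
  obtain ⟨h3, h4⟩ := hS s hs
  refine (h.add_le_mul_exp h4 u).trans ?_
  rw [mul_comm]
  refine mul_le_mul_of_nonneg_right ?_ (h.pos s).le
  rw [← Real.le_log_iff_exp_le (by linarith)]
  refine le_trans ?_ h3.le
  have : 0 ≤ Real.log (r s) / s := div_nonneg (h.log_pos s).le s.2
  gcongr

end IsLambdaZero

/-- The properties of a subgeometric rate that drive the estimates: submultiplicativity, slow
variation at infinity, and domination of the rate by its own integral. -/
structure IsTameWeight (V : ℝ≥0 → ℝ≥0∞) : Prop where
  measurable : Measurable V
  add_le : ∀ s t, V (s + t) ≤ V s * V t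
  slow : ∀ (T : ℝ≥0) (θ : ℝ≥0), 1 < θ → ∃ S : ℝ≥0, ∀ s ≥ S, ∀ u ≤ T, V (s + u) ≤ θ * V s
  le_integral : ∀ h : ℝ≥0, 0 < h → ∃ c : ℝ≥0, ∀ t ≥ h, V t ≤ c * ∫⁻ u in Set.Iic t, V u ∂timeMeasure
  little_o : ∀ η : ℝ≥0, 0 < η → ∃ T : ℝ≥0, ∀ t ≥ T, V t ≤ η * ∫⁻ u in Set.Iic t, V u ∂timeMeasure

/-- If `V t` is at most `k` times each value of `V` on `[t - h, t]`, then `h V(t)` is at most `k`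
times the integral of `V`. -/
theorem le_mul_setLIntegral_Iic {V : ℝ≥0 → ℝ≥0∞} {h k t : ℝ≥0} (hh : 0 < h)
    (hht : h ≤ t) (hk : ∀ u ∈ Set.Icc (t - h) t, V t ≤ k * V u) :
    V t ≤ (k / h : ℝ≥0) * ∫⁻ u in Set.Iic t, V u ∂timeMeasure := by
  have h1 : V t * h ≤ k * ∫⁻ u in Set.Iic t, V u ∂timeMeasure := by
    calc V t * h = ∫⁻ _ in Set.Icc (t - h) t, V t ∂timeMeasure := by
          rw [setLIntegral_const, timeMeasure_Icc, tsub_tsub_cancel_of_le hht]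
      _ ≤ ∫⁻ u in Set.Icc (t - h) t, k * V u ∂timeMeasure :=
          setLIntegral_mono' measurableSet_Icc hk
      _ ≤ ∫⁻ u in Set.Iic t, k * V u ∂timeMeasure :=
          lintegral_mono_set Set.Icc_subset_Iic_self
      _ = k * ∫⁻ u in Set.Iic t, V u ∂timeMeasure :=
          lintegral_const_mul' _ _ ENNReal.coe_ne_top
  have hh0 : (h : ℝ≥0∞) ≠ 0 := by exact_mod_cast hh.ne'
  rw [ENNReal.coe_div hh.ne', ← ENNReal.mul_div_right_comm,
    ENNReal.le_div_iff_mul_le (Or.inl hh0) (Or.inl ENNReal.coe_ne_top)]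
  exact h1

theorem IsLambdaZero.isTameWeight {r : ℝ≥0 → ℝ} (h : IsLambdaZero r) :
    IsTameWeight fun t => ENNReal.ofReal (r t) := by
  have hslow : ∀ (T : ℝ≥0) (θ : ℝ≥0), 1 < θ → ∃ S : ℝ≥0, ∀ s ≥ S, ∀ u ≤ T,
      ENNReal.ofReal (r (s + u)) ≤ θ * ENNReal.ofReal (r s) := fun T θ hθ => by
    obtain ⟨S, hS⟩ := h.exists_add_le_mul T (θ := θ) (by exact_mod_cast hθ)
    refine ⟨S, fun s hs u hu => ?_⟩
    rw [← ENNReal.ofReal_coe_nnreal, ← ENNReal.ofReal_mul (NNReal.coe_nonneg _)]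
    exact ENNReal.ofReal_le_ofReal (hS s hs u hu)
  refine ⟨h.measurable.ennreal_ofReal, fun s t => ?_, hslow, fun a ha => ?_, fun η hη => ?_⟩
  · rw [← ENNReal.ofReal_mul (h.pos s).le]
    exact ENNReal.ofReal_le_ofReal (h.add_le_mul s t)
  · refine ⟨(r a).toNNReal / a, fun t ht =>
      le_mul_setLIntegral_Iic (V := fun t => ENNReal.ofReal (r t)) ha ht fun u hu => ?_⟩
    change _ ≤ ENNReal.ofReal (r a) * _
    rw [← ENNReal.ofReal_mul (h.pos a).le]
    refine ENNReal.ofReal_le_ofReal (((h.monotone ?_).trans (h.add_le_mul a u)))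
    rw [add_comm]; exact tsub_le_iff_right.1 hu.1
  · -- a window of length `2 / η`, along which `r` varies by a factor at most `2`
    obtain ⟨S, hS⟩ := hslow (2 / η) 2 one_lt_two
    have hpos : 0 < 2 / η := by positivity
    refine ⟨S + 2 / η, fun t ht => ?_⟩
    have h1 := le_mul_setLIntegral_Iic (V := fun t => ENNReal.ofReal (r t)) (k := 2) (t := t) hpos
      (le_add_self.trans ht) fun u hu => by
        have h2 := hS u ((le_tsub_of_add_le_right ht).trans hu.1) (t - u)
          (tsub_le_iff_tsub_le.1 hu.1)
        rwa [add_tsub_cancel_of_le hu.2] at h2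
    rwa [div_div_cancel₀ (by norm_num)] at h1

/-- The rate `r` is of the same order as the tame weight `V`, on all of `[0, ∞)`. -/
structure IsComparable (r : ℝ≥0 → ℝ) (V : ℝ≥0 → ℝ≥0∞) (c₁ c₂ : ℝ≥0) : Prop where
  measurable : Measurable r
  tame : IsTameWeight V
  le_rate : ∀ t, V t ≤ c₁ * ENNReal.ofReal (r t)
  rate_le : ∀ t, ENNReal.ofReal (r t) ≤ c₂ * V t

theorem IsSubgeometricRate.exists_isComparable {r : ℝ≥0 → ℝ} (hr : IsSubgeometricRate r)
    (hr_loc : ∀ T : ℝ≥0, ∃ a b : ℝ, 0 < a ∧ ∀ t ≤ T, a ≤ r t ∧ r t ≤ b) :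
    ∃ (V : ℝ≥0 → ℝ≥0∞) (c₁ c₂ : ℝ≥0), IsComparable r V c₁ c₂ := by
  obtain ⟨hmeas, hpos, r₀, h₀, hinf, hsup⟩ := hr
  obtain ⟨a, ha0, ha⟩ := ENNReal.lt_iff_exists_nnreal_btwn.1 hinf
  obtain ⟨b, hb, -⟩ := ENNReal.lt_iff_exists_nnreal_btwn.1 hsup
  have ha0' : 0 < a := by exact_mod_cast ha0
  obtain ⟨T, hT⟩ := ((eventually_lt_of_lt_liminf ha).and
    (eventually_lt_of_limsup_lt hb)).exists_forall_of_atTop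
  obtain ⟨a', b', ha', hab'⟩ := hr_loc T
  refine ⟨fun t => ENNReal.ofReal (r₀ t), max a⁻¹ (r₀ T / a').toNNReal, max b b'.toNNReal,
    hmeas, h₀.isTameWeight, fun t => ?_, fun t => ?_⟩
  · have : r₀ t ≤ (max a⁻¹ (r₀ T / a').toNNReal : ℝ≥0) * r t := by
      rcases le_total t T with ht | ht
      · calc r₀ t ≤ r₀ T := h₀.monotone ht
          _ = r₀ T / a' * a' := by field_simp
          _ ≤ (max a⁻¹ (r₀ T / a').toNNReal : ℝ≥0) * r t := by
            gcongr
            · exact (Real.le_coe_toNNReal _).trans (by exact_mod_cast le_max_right _ _)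
            · exact (hab' t ht).1
      · have h1 : (a : ℝ) ≤ r t / r₀ t := by
          have := (hT t ht).1.le
          rwa [ENNReal.le_ofReal_iff_toReal_le ENNReal.coe_ne_top
            (div_nonneg (hpos t).le (h₀.pos t).le)] at this
        rw [le_div_iff₀ (h₀.pos t)] at h1
        have ha0'' : (0 : ℝ) < a := ha0'
        have h0 : 0 ≤ (a : ℝ) * r₀ t := (mul_pos ha0'' (h₀.pos t)).le
        calc r₀ t = (a : ℝ)⁻¹ * (a * r₀ t) := by field_simp
          _ ≤ (max a⁻¹ (r₀ T / a').toNNReal : ℝ≥0) * r t := by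
            gcongr
            exact_mod_cast le_max_left a⁻¹ _
    rw [← ENNReal.ofReal_coe_nnreal, ← ENNReal.ofReal_mul (NNReal.coe_nonneg _)]
    exact ENNReal.ofReal_le_ofReal this
  · have : r t ≤ (max b b'.toNNReal : ℝ≥0) * r₀ t := by
      rcases le_total t T with ht | ht
      · calc r t ≤ b' := (hab' t ht).2
          _ ≤ b'.toNNReal := Real.le_coe_toNNReal _
          _ ≤ b'.toNNReal * r₀ t := by nlinarith [h₀.two_le t, b'.toNNReal.2]
          _ ≤ _ := by
            have := (h₀.pos t).le
            gcongr
            exact_mod_cast le_max_right _ _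
      · have h1 : r t / r₀ t ≤ b := by
          have := (hT t ht).2.le
          rw [← ENNReal.ofReal_coe_nnreal] at this
          exact (ENNReal.ofReal_le_ofReal_iff b.2).1 this
        rw [div_le_iff₀ (h₀.pos t)] at h1
        refine h1.trans ?_
        have := (h₀.pos t).le
        gcongr
        exact_mod_cast le_max_left _ _
    rw [← ENNReal.ofReal_coe_nnreal, ← ENNReal.ofReal_mul (NNReal.coe_nonneg _)]
    exact ENNReal.ofReal_le_ofReal this

/-! ### Stopping times that reach a closed set -/

section Hitting

variable {Ω E : Type*} [MetricSpace E] {m : MeasurableSpace Ω}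

/-- The times `t ≥ T` such that the path `w` comes arbitrarily close to `C` during `[T, t]`. -/
def approachTimes (w : ℝ≥0 → E) (C : Set E) (T : WithTop ℝ≥0) : Set ℝ≥0 :=
  {t | T ≤ t ∧ ∀ n : ℕ, ∃ s ≤ t, T ≤ s ∧ Metric.infEDist (w s) C < (n + 1 : ℝ≥0∞)⁻¹}

open scoped Classical in
/-- The first time after `T` at which the path `w` has come arbitrarily close to `C`.  The path
need not be in `C` then: it may only have its left limit there. -/
noncomputable def approachTime (w : ℝ≥0 → E) (C : Set E) (T : WithTop ℝ≥0) : WithTop ℝ≥0 :=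
  if (approachTimes w C T).Nonempty then ((sInf (approachTimes w C T) : ℝ≥0) : WithTop ℝ≥0) else ⊤

/-- The infimum defining `approachTime` is attained, because the path is right-continuous. -/
theorem sInf_mem_approachTimes {w : ℝ≥0 → E} (hw : ∀ t, ContinuousWithinAt w (Set.Ici t) t)
    {C : Set E} {T : WithTop ℝ≥0} (hne : (approachTimes w C T).Nonempty) :
    sInf (approachTimes w C T) ∈ approachTimes w C T := by
  set S := approachTimes w C T
  set a := sInf S
  lift T to ℝ≥0 using ne_top_of_le_ne_top WithTop.coe_ne_top hne.choose_spec.1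
  have hTa : T ≤ a := le_csInf hne fun t ht => WithTop.coe_le_coe.1 ht.1
  refine ⟨WithTop.coe_le_coe.2 hTa, fun n => ?_⟩
  by_cases ha : Metric.infEDist (w a) C < (n + 1 : ℝ≥0∞)⁻¹
  · exact ⟨a, le_rfl, WithTop.coe_le_coe.2 hTa, ha⟩
  -- otherwise the path stays away from `C` just after `a`, so the approach takes place before `a`
  have hlt : ((n + 1 : ℕ) + 1 : ℝ≥0∞)⁻¹ < (n + 1 : ℝ≥0∞)⁻¹ := by
    rw [ENNReal.inv_lt_inv]
    exact_mod_cast Nat.lt_succ_self (n + 1)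
  have hev : ∀ᶠ s in 𝓝[≥] a, ((n + 1 : ℕ) + 1 : ℝ≥0∞)⁻¹ < Metric.infEDist (w s) C :=
    (Metric.continuous_infEDist.continuousAt.comp_continuousWithinAt (hw a)).eventually
      (lt_mem_nhds (hlt.trans_le (not_lt.1 ha)))
  obtain ⟨u, hu, hus⟩ := mem_nhdsGE_iff_exists_Ico_subset.1 hev
  obtain ⟨t, ht, htu⟩ := exists_lt_of_csInf_lt hne hu
  obtain ⟨s, hst, hTs, hs⟩ := ht.2 (n + 1)
  have hsa : s < a := by
    by_contra hsa
    exact lt_asymm hs (hus ⟨not_lt.1 hsa, hst.trans_lt htu⟩)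
  exact ⟨s, hsa.le, hTs, hs.trans hlt⟩

theorem approachTime_le_iff {w : ℝ≥0 → E} (hw : ∀ t, ContinuousWithinAt w (Set.Ici t) t)
    {C : Set E} {T : WithTop ℝ≥0} {t : ℝ≥0} :
    approachTime w C T ≤ t ↔ t ∈ approachTimes w C T := by
  unfold approachTime
  split_ifs with h
  · refine ⟨fun hle => ?_, fun ht => WithTop.coe_le_coe.2 (csInf_le (OrderBot.bddBelow _) ht)⟩
    obtain ⟨h1, h2⟩ := sInf_mem_approachTimes hw h
    rw [WithTop.coe_le_coe] at hle
    refine ⟨h1.trans (WithTop.coe_le_coe.2 hle), fun n => ?_⟩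
    obtain ⟨s, hs, hs'⟩ := h2 n
    exact ⟨s, hs.trans hle, hs'⟩
  · exact ⟨fun hle => absurd hle (WithTop.coe_lt_top t).not_ge, fun ht => absurd ⟨t, ht⟩ h⟩

theorem le_approachTime {w : ℝ≥0 → E} (hw : ∀ t, ContinuousWithinAt w (Set.Ici t) t)
    {C : Set E} {T : WithTop ℝ≥0} : T ≤ approachTime w C T := by
  induction h : approachTime w C T using WithTop.recTopCoe with
  | top => exact le_top
  | coe t => exact ((approachTime_le_iff hw).1 h.le).1

theorem approachTime_le_of_mem {w : ℝ≥0 → E} (hw : ∀ t, ContinuousWithinAt w (Set.Ici t) t)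
    {C : Set E} {T : WithTop ℝ≥0} {t : ℝ≥0} (hT : T ≤ t) (ht : w t ∈ C) :
    approachTime w C T ≤ t :=
  (approachTime_le_iff hw).2 ⟨hT, fun n => ⟨t, le_rfl, hT, by
    rw [Metric.infEDist_zero_of_mem ht]; simp⟩⟩

theorem mem_of_approachTime_le {w : ℝ≥0 → E} (hw : ∀ t, ContinuousWithinAt w (Set.Ici t) t)
    {C : Set E} (hC : IsClosed C) {t : ℝ≥0} (h : approachTime w C t ≤ t) : w t ∈ C := by
  have h1 := ((approachTime_le_iff hw).1 h).2
  have h2 : ∀ n : ℕ, Metric.infEDist (w t) C < (n + 1 : ℝ≥0∞)⁻¹ := fun n => by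
    obtain ⟨s, hst, hts, hs⟩ := h1 n
    rwa [le_antisymm hst (WithTop.coe_le_coe.1 hts)] at hs
  rw [← hC.closure_eq, Metric.mem_closure_iff_infEDist_zero]
  by_contra h0
  obtain ⟨n, hn⟩ := ENNReal.exists_inv_nat_lt h0
  exact lt_asymm ((h2 n).trans_le (ENNReal.inv_le_inv.2 le_self_add)) hn

/-- Membership in `approachTimes` at time `t` depends only on `t` and countably many earlier times,
which makes `approachTime` a stopping time. -/
theorem mem_approachTimes_iff_denseSeq {w : ℝ≥0 → E} (hw : ∀ t, ContinuousWithinAt w (Set.Ici t) t)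
    {C : Set E} {T : WithTop ℝ≥0} {t : ℝ≥0} :
    t ∈ approachTimes w C T ↔ T ≤ t ∧ ∀ n : ℕ,
      Metric.infEDist (w t) C < (n + 1 : ℝ≥0∞)⁻¹ ∨
      ∃ k, TopologicalSpace.denseSeq ℝ≥0 k ≤ t ∧ T ≤ (TopologicalSpace.denseSeq ℝ≥0 k : WithTop ℝ≥0) ∧
        Metric.infEDist (w (TopologicalSpace.denseSeq ℝ≥0 k)) C < (n + 1 : ℝ≥0∞)⁻¹ := by
  refine and_congr_right fun hT => forall_congr' fun n => ⟨?_, ?_⟩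
  · rintro ⟨s, hst, hTs, hs⟩
    rcases hst.eq_or_lt with rfl | hlt
    · exact Or.inl hs
    · have hev : ∀ᶠ u in 𝓝[≥] s, Metric.infEDist (w u) C < (n + 1 : ℝ≥0∞)⁻¹ :=
        (Metric.continuous_infEDist.continuousAt.comp_continuousWithinAt (hw s)).eventually
          (gt_mem_nhds hs)
      obtain ⟨u, hu, hus⟩ := mem_nhdsGE_iff_exists_Ico_subset.1 hev
      obtain ⟨k, hk1, hk2⟩ := (TopologicalSpace.denseRange_denseSeq ℝ≥0).exists_mem_open isOpen_Ioo
        (Set.nonempty_Ioo.2 (lt_min hu hlt))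
      exact Or.inr ⟨k, (hk2.trans_le (min_le_right _ _)).le, hTs.trans (WithTop.coe_le_coe.2 hk1.le),
        hus ⟨hk1.le, hk2.trans_le (min_le_left _ _)⟩⟩
  · rintro (h | ⟨k, hk, hTk, h⟩)
    · exact ⟨t, le_rfl, hT, h⟩
    · exact ⟨_, hk, hTk, h⟩

variable [MeasurableSpace E] [BorelSpace E] {ℱ : Filtration ℝ≥0 m} {X : ℝ≥0 → Ω → E}

theorem isStoppingTime_approachTime (hX : ∀ t, Measurable[ℱ t] (X t))
    (hcont : ∀ ω t, ContinuousWithinAt (fun s => X s ω) (Set.Ici t) t) (C : Set E)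
    {T : Ω → WithTop ℝ≥0} (hT : IsStoppingTime ℱ T) :
    IsStoppingTime ℱ fun ω => approachTime (fun s => X s ω) C (T ω) := by
  intro t
  have hd : ∀ s ≤ t, ∀ n : ℕ,
      MeasurableSet[ℱ t] {ω | Metric.infEDist (X s ω) C < (n + 1 : ℝ≥0∞)⁻¹} := fun s hs n =>
    ℱ.mono hs _ (hX s (measurableSet_lt measurable_infEDist measurable_const))
  have hq : ∀ n k : ℕ, MeasurableSet[ℱ t] {ω | TopologicalSpace.denseSeq ℝ≥0 k ≤ t ∧
      T ω ≤ (TopologicalSpace.denseSeq ℝ≥0 k : WithTop ℝ≥0) ∧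
      Metric.infEDist (X (TopologicalSpace.denseSeq ℝ≥0 k) ω) C < (n + 1 : ℝ≥0∞)⁻¹} := fun n k => by
    by_cases hk : TopologicalSpace.denseSeq ℝ≥0 k ≤ t
    · simp only [hk, true_and]
      exact (ℱ.mono hk _ (hT _)).inter (hd _ hk n)
    · simp [hk]
  have hset : {ω | approachTime (fun s => X s ω) C (T ω) ≤ t} = {ω | T ω ≤ t} ∩ ⋂ n : ℕ,
      ({ω | Metric.infEDist (X t ω) C < (n + 1 : ℝ≥0∞)⁻¹} ∪ ⋃ k, {ω | TopologicalSpace.denseSeq ℝ≥0 k ≤ t ∧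
        T ω ≤ (TopologicalSpace.denseSeq ℝ≥0 k : WithTop ℝ≥0) ∧
        Metric.infEDist (X (TopologicalSpace.denseSeq ℝ≥0 k) ω) C < (n + 1 : ℝ≥0∞)⁻¹}) := by
    ext ω
    simp only [Set.mem_ofPred_eq, Set.mem_inter_iff, Set.mem_iInter, Set.mem_union, Set.mem_iUnion]
    rw [approachTime_le_iff (hcont ω), mem_approachTimes_iff_denseSeq (hcont ω)]
  rw [hset]
  exact (hT t).inter (MeasurableSet.iInter fun n => (hd t le_rfl n).union
    (MeasurableSet.iUnion fun k => hq n k))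

/-- Hitting times of closed sets need not be stopping times of a filtration that is neither
complete nor right-continuous.  For each law there is nevertheless a stopping time `T`, not later
than any visit to `C` after time `ρ`, at which the process is almost surely in `C`: a maximal one
among the stopping times that precede all these visits.  Maximality is tested against
`approachTime`, which moves forward every stopping time at which the process is outside `C`. -/
theorem exists_isStoppingTime_hitting (hX : ∀ t, Measurable[ℱ t] (X t))
    (hcont : ∀ ω t, ContinuousWithinAt (fun s => X s ω) (Set.Ici t) t) {C : Set E}
    (hC : IsClosed C) {ρ : Ω → WithTop ℝ≥0} (hρ : IsStoppingTime ℱ ρ) (μ : Measure Ω)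
    [IsFiniteMeasure μ] :
    ∃ T : Ω → WithTop ℝ≥0, IsStoppingTime ℱ T ∧ (∀ ω, ρ ω ≤ T ω) ∧
      (∀ ω (t : ℝ≥0), ρ ω ≤ t → X t ω ∈ C → T ω ≤ t) ∧
      ∀ᵐ ω ∂μ, ∀ t : ℝ≥0, T ω = t → X t ω ∈ C := by
  let 𝒯 : Set (Ω → WithTop ℝ≥0) := {T | IsStoppingTime ℱ T ∧ (∀ ω, ρ ω ≤ T ω) ∧
    ∀ ω (t : ℝ≥0), ρ ω ≤ t → X t ω ∈ C → T ω ≤ t}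
  -- `WithTop ℝ≥0` is `ℝ≥0∞`; the function `x ↦ (1 + x)⁻¹` is bounded and strictly decreasing
  let e : WithTop ℝ≥0 → ℝ≥0∞ := fun x => x
  let φ : (Ω → WithTop ℝ≥0) → Ω → ℝ≥0∞ := fun T ω => (1 + e (T ω))⁻¹
  have hφmeas : ∀ T, IsStoppingTime ℱ T → Measurable (φ T) := fun T hT => by
    have : Measurable fun ω => e (T ω) := hT.measurable'
    exact (measurable_const.add this).inv
  have hφle : ∀ T T' : Ω → WithTop ℝ≥0, (∀ ω, T ω ≤ T' ω) → φ T' ≤ φ T := fun T T' h ω =>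
    ENNReal.inv_le_inv.2 (add_le_add_right (h ω) 1)
  have hφinj : ∀ T T' : Ω → WithTop ℝ≥0, ∀ ω, φ T ω = φ T' ω → T ω = T' ω := fun T T' ω h =>
    (ENNReal.add_right_inj ENNReal.one_ne_top).1 (inv_injective (show (1 + e (T ω))⁻¹ = (1 + e (T' ω))⁻¹ from h))
  have hφtop : ∀ T, ∫⁻ ω, φ T ω ∂μ ≠ ⊤ := fun T => by
    refine ne_top_of_le_ne_top (measure_ne_top μ Set.univ) ?_
    rw [← lintegral_one]
    exact lintegral_mono fun ω => ENNReal.inv_le_one.2 le_self_add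
  obtain ⟨u, -, hu, huS⟩ := exists_seq_tendsto_sInf
    (S := (fun T => ∫⁻ ω, φ T ω ∂μ) '' 𝒯)
    ⟨_, ρ, ⟨hρ, fun _ => le_rfl, fun _ _ h _ => h⟩, rfl⟩ (OrderBot.bddBelow _)
  choose Ts hTs hTsu using huS
  let T : Ω → WithTop ℝ≥0 := fun ω => ⨆ n, Ts n ω
  have hT𝒯 : T ∈ 𝒯 := by
    refine ⟨fun t => ?_, fun ω => ((hTs 0).2.1 ω).trans (le_iSup (fun n => Ts n ω) 0),
      fun ω t h h' => iSup_le fun n => (hTs n).2.2 ω t h h'⟩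
    have hset : {ω | T ω ≤ t} = ⋂ n, {ω | Ts n ω ≤ t} := by
      ext ω
      simp only [Set.mem_ofPred_eq, Set.mem_iInter]
      exact ⟨fun h i => (le_iSup (fun n => Ts n ω) i).trans h, fun h => iSup_le h⟩
    rw [hset]
    exact MeasurableSet.iInter fun n => (hTs n).1 t
  have hmin : ∀ T' ∈ 𝒯, ∫⁻ ω, φ T ω ∂μ ≤ ∫⁻ ω, φ T' ω ∂μ := fun T' hT' => by
    refine le_trans ?_ (sInf_le (Set.mem_image_of_mem (fun T => ∫⁻ ω, φ T ω ∂μ) hT'))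
    refine ge_of_tendsto' hu fun n => ?_
    rw [← hTsu n]
    exact lintegral_mono (hφle _ _ fun ω => le_iSup (fun n => Ts n ω) n)
  let T' : Ω → WithTop ℝ≥0 := fun ω => approachTime (fun s => X s ω) C (T ω)
  have hTT' : ∀ ω, T ω ≤ T' ω := fun ω => le_approachTime (hcont ω)
  have hT'𝒯 : T' ∈ 𝒯 := ⟨isStoppingTime_approachTime hX hcont C hT𝒯.1,
    fun ω => (hT𝒯.2.1 ω).trans (hTT' ω),
    fun ω t h h' => approachTime_le_of_mem (hcont ω) (hT𝒯.2.2 ω t h h') h'⟩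
  refine ⟨T, hT𝒯.1, hT𝒯.2.1, hT𝒯.2.2, ?_⟩
  filter_upwards [ae_eq_of_ae_le_of_lintegral_le (Eventually.of_forall (hφle T T' hTT'))
    (hφtop T') (hφmeas T hT𝒯.1).aemeasurable (hmin T' hT'𝒯)] with ω hω t ht
  have h1 : T' ω = T ω := hφinj _ _ _ hω
  refine mem_of_approachTime_le (hcont ω) hC ?_
  rw [← ht]
  exact h1.le

end Hitting

/-! ### The space of right-continuous paths -/

/-- Right-continuous paths, with the σ-algebra generated by the coordinates. -/
abbrev PathSpace (E : Type*) [TopologicalSpace E] : Type _ :=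
  {w : ℝ≥0 → E // ∀ t, ContinuousWithinAt w (Set.Ici t) t}

section PathSpace

variable {E : Type*} [MetricSpace E] [MeasurableSpace E] [BorelSpace E]

theorem measurable_pathSpace_eval :
    Measurable fun p : PathSpace E × ℝ≥0 => p.1.1 p.2 := by
  -- evaluate at the next point of the grid of mesh `1 / (n + 1)`
  let s : ℕ → ℝ≥0 → ℝ≥0 := fun n t => (⌊(n + 1 : ℝ≥0) * t⌋₊ + 1) / (n + 1)
  have hs : ∀ n t, t ≤ s n t ∧ s n t ≤ t + 1 / (n + 1) := fun n t => by
    have hn : (0 : ℝ≥0) < n + 1 := by positivity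
    constructor
    · rw [le_div_iff₀ hn, mul_comm]
      exact (Nat.lt_floor_add_one _).le
    · have : ((⌊(n + 1 : ℝ≥0) * t⌋₊ : ℝ≥0)) ≤ (n + 1) * t := Nat.floor_le (zero_le)
      calc ((⌊(n + 1 : ℝ≥0) * t⌋₊ : ℝ≥0) + 1) / (n + 1) ≤ ((n + 1) * t + 1) / (n + 1) := by gcongr
        _ = t + 1 / (n + 1) := by field_simp
  have hmeas : ∀ n, Measurable fun p : PathSpace E × ℝ≥0 => p.1.1 (s n p.2) := fun n => by
    have h1 : Measurable fun p : PathSpace E × ℕ => p.1.1 ((p.2 + 1 : ℝ≥0) / (n + 1)) :=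
      measurable_from_prod_countable_left fun k => (measurable_pi_apply
        (((k : ℝ≥0) + 1) / (n + 1))).comp measurable_subtype_coe
    exact h1.comp (measurable_fst.prodMk
      (Nat.measurable_floor.comp (measurable_const.mul measurable_snd)))
  refine measurable_of_tendsto_metrizable hmeas (tendsto_pi_nhds.2 fun p => ?_)
  refine (p.1.2 p.2).tendsto.comp (tendsto_nhdsWithin_iff.2 ⟨?_, .of_forall fun n => (hs n _).1⟩)
  refine tendsto_of_tendsto_of_tendsto_of_le_of_le tendsto_const_nhds ?_ (fun n => (hs n _).1)
    fun n => (hs n _).2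
  have h2 : Tendsto (fun n : ℕ => p.2 + 1 / ((n : ℝ≥0) + 1)) atTop (𝓝 (p.2 + 0)) :=
    tendsto_const_nhds.add tendsto_one_div_add_atTop_nhds_zero_nat
  simpa using h2

theorem measurable_pathSpace_eval_comp {α : Type*} [MeasurableSpace α] {w : α → PathSpace E}
    {t : α → ℝ≥0} (hw : Measurable w) (ht : Measurable t) : Measurable fun a => (w a).1 (t a) :=
  measurable_pathSpace_eval.comp (hw.prodMk ht)

end PathSpace

theorem eq_coe_untopD {τ : WithTop ℝ≥0} (h : τ < ⊤) : τ = ((τ.untopD 0 : ℝ≥0) : WithTop ℝ≥0) := by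
  lift τ to ℝ≥0 using h.ne
  rfl

/-- `∫₀^τ V(u) g(w(u)) du`. -/
noncomputable def pathIntegral {E : Type*} (V : ℝ≥0 → ℝ≥0∞) (g : E → ℝ≥0∞) (τ : WithTop ℝ≥0)
    (w : ℝ≥0 → E) : ℝ≥0∞ :=
  ∫⁻ u in {u : ℝ≥0 | (u : WithTop ℝ≥0) ≤ τ}, V u * g (w u) ∂timeMeasure

section PathIntegral

variable {E : Type*}

theorem pathIntegral_mono {V V' : ℝ≥0 → ℝ≥0∞} {g : E → ℝ≥0∞} {τ τ' : WithTop ℝ≥0} {w : ℝ≥0 → E}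
    (hV : ∀ t, V t ≤ V' t) (hτ : τ ≤ τ') : pathIntegral V g τ w ≤ pathIntegral V' g τ' w :=
  (lintegral_mono_set fun _ hu => le_trans hu hτ).trans
    (lintegral_mono fun u => mul_le_mul_left (hV u) _)

theorem pathIntegral_one_le {B : Set E} (L : ℝ≥0) (w : ℝ≥0 → E) :
    pathIntegral 1 (B.indicator 1) L w ≤ L := by
  calc pathIntegral 1 (B.indicator 1) L w
      ≤ ∫⁻ _ in {u : ℝ≥0 | (u : WithTop ℝ≥0) ≤ L}, 1 ∂timeMeasure := by
        refine lintegral_mono fun u => ?_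
        rw [Pi.one_apply, one_mul]
        exact Set.indicator_le_self' (fun _ _ => zero_le) _
    _ = L := by
        rw [setLIntegral_one]
        have : {u : ℝ≥0 | (u : WithTop ℝ≥0) ≤ L} = Set.Icc 0 L := by
          ext u
          exact ⟨fun hu => ⟨zero_le, WithTop.coe_le_coe.1 hu⟩, fun hu => WithTop.coe_le_coe.2 hu.2⟩
        rw [this, timeMeasure_Icc, tsub_zero]

theorem pathIntegral_const_mul {V : ℝ≥0 → ℝ≥0∞} {g : E → ℝ≥0∞} {τ : WithTop ℝ≥0} {w : ℝ≥0 → E}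
    (c : ℝ≥0) : pathIntegral (fun t => c * V t) g τ w = c * pathIntegral V g τ w := by
  unfold pathIntegral
  rw [← lintegral_const_mul' _ _ ENNReal.coe_ne_top]
  simp_rw [mul_assoc]

variable [MetricSpace E] [MeasurableSpace E] [BorelSpace E]

theorem measurable_pathIntegral {V : ℝ≥0 → ℝ≥0∞} (hV : Measurable V) {g : E → ℝ≥0∞}
    (hg : Measurable g) {α : Type*} [MeasurableSpace α] {w : α → PathSpace E} (hw : Measurable w)
    {τ : α → WithTop ℝ≥0} (hτ : Measurable τ) :
    Measurable fun a => pathIntegral V g (τ a) (w a).1 := by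
  unfold pathIntegral
  simp_rw [← lintegral_indicator (measurableSet_coe_le _)]
  have h1 : MeasurableSet {p : α × ℝ≥0 | (p.2 : WithTop ℝ≥0) ≤ τ p.1} :=
    measurableSet_le (WithTop.measurable_coe.comp measurable_snd) (hτ.comp measurable_fst)
  have h2 : Measurable fun p : α × ℝ≥0 => V p.2 * g ((w p.1).1 p.2) :=
    (hV.comp measurable_snd).mul
      (hg.comp (measurable_pathSpace_eval_comp (hw.comp measurable_fst) measurable_snd))
  exact (h2.indicator h1).lintegral_prod_right'

theorem measurable_setLIntegral_Ioc {V : ℝ≥0 → ℝ≥0∞} (hV : Measurable V) {g : E → ℝ≥0∞}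
    (hg : Measurable g) {α : Type*} [MeasurableSpace α] {w : α → PathSpace E} (hw : Measurable w)
    {σ τ : α → WithTop ℝ≥0} (hσ : Measurable σ) (hτ : Measurable τ) :
    Measurable fun a => ∫⁻ u in {u : ℝ≥0 | σ a < u ∧ (u : WithTop ℝ≥0) ≤ τ a},
      V u * g ((w a).1 u) ∂timeMeasure := by
  have hS : ∀ a, MeasurableSet {u : ℝ≥0 | σ a < u ∧ (u : WithTop ℝ≥0) ≤ τ a} := fun a =>
    (measurableSet_lt measurable_const WithTop.measurable_coe).inter (measurableSet_coe_le _)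
  simp_rw [← lintegral_indicator (hS _)]
  have h1 : MeasurableSet {p : α × ℝ≥0 | σ p.1 < p.2 ∧ (p.2 : WithTop ℝ≥0) ≤ τ p.1} :=
    (measurableSet_lt (hσ.comp measurable_fst) (WithTop.measurable_coe.comp measurable_snd)).inter
      (measurableSet_le (WithTop.measurable_coe.comp measurable_snd) (hτ.comp measurable_fst))
  have h2 : Measurable fun p : α × ℝ≥0 => V p.2 * g ((w p.1).1 p.2) :=
    (hV.comp measurable_snd).mul
      (hg.comp (measurable_pathSpace_eval_comp (hw.comp measurable_fst) measurable_snd))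
  exact (h2.indicator h1).lintegral_prod_right'

end PathIntegral

namespace StrongMarkovFamily

variable {E Ω : Type*} [MetricSpace E] [MeasurableSpace E] [MeasurableSpace Ω]
  (M : StrongMarkovFamily E Ω)

instance (x : E) : IsProbabilityMeasure (M.P x) := M.isProbabilityMeasure x

/-- The path of the process, as a point of the path space. -/
def path (ω : Ω) : PathSpace E := ⟨fun t => M.X t ω, M.right_continuous ω⟩

/-- The path of the process after time `τ` (after time `0`, if `τ = ∞`). -/
def postPath (τ : WithTop ℝ≥0) (ω : Ω) : PathSpace E :=
  ⟨fun t => M.X (τ.untopD 0 + t) ω, fun t => by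
    refine ContinuousWithinAt.comp (t := Set.Ici (τ.untopD 0 + t)) (M.right_continuous ω _)
      (by fun_prop) fun s hs => ?_
    exact add_le_add_right (Set.mem_Ici.1 hs) _⟩

/-- The law of the path under `P x`. -/
noncomputable def law (x : E) : Measure (PathSpace E) := (M.P x).map M.path

theorem measurable_X (t : ℝ≥0) : Measurable (M.X t) := (M.adapted t).mono (M.ℱ.le t) le_rfl

theorem measurable_path : Measurable M.path :=
  Measurable.subtype_mk (measurable_pi_lambda _ M.measurable_X)

instance (x : E) : IsProbabilityMeasure (M.law x) :=
  Measure.isProbabilityMeasure_map M.measurable_path.aemeasurable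

theorem lintegral_law (x : E) {H : PathSpace E → ℝ≥0∞} (hH : Measurable H) :
    ∫⁻ w, H w ∂M.law x = ∫⁻ ω, H (M.path ω) ∂M.P x :=
  lintegral_map hH M.measurable_path

theorem measurable_law' : Measurable M.law := by
  refine Measure.measurable_of_measurable_coe _ fun S hS => ?_
  obtain ⟨A, hA, rfl⟩ := hS
  have : (fun x => M.law x (Subtype.val ⁻¹' A)) = fun x => M.P x {ω | (fun t => M.X t ω) ∈ A} := by
    funext x
    exact Measure.map_apply M.measurable_path (measurable_subtype_coe hA)
  rw [this]
  exact M.measurable_law A hA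

variable [BorelSpace E]

theorem measurable_postPath {σ : Ω → WithTop ℝ≥0} (hσ : Measurable σ) :
    Measurable fun ω => M.postPath (σ ω) ω :=
  Measurable.subtype_mk (measurable_pi_lambda _ fun _ =>
    measurable_pathSpace_eval_comp M.measurable_path ((hσ.untopD 0).add_const _))

/-- The strong Markov property for functionals of the path after a stopping time. -/
theorem setLIntegral_postPath (x : E) {σ : Ω → WithTop ℝ≥0} (hσ : IsStoppingTime M.ℱ σ)
    {F : Set Ω} (hF : MeasurableSet[hσ.measurableSpace] F) {H : PathSpace E → ℝ≥0∞}
    (hH : Measurable H) :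
    ∫⁻ ω in F ∩ {ω | σ ω < ⊤}, H (M.postPath (σ ω) ω) ∂M.P x =
      ∫⁻ ω in F ∩ {ω | σ ω < ⊤}, ∫⁻ w, H w ∂M.law (M.X ((σ ω).untopD 0) ω) ∂M.P x := by
  have hpost := M.measurable_postPath hσ.measurable'
  have hXσ : Measurable fun ω => M.X ((σ ω).untopD 0) ω :=
    measurable_pathSpace_eval_comp M.measurable_path (hσ.measurable'.untopD 0)
  have hlaw : Measurable fun ω => M.law (M.X ((σ ω).untopD 0) ω) := M.measurable_law'.comp hXσ
  have hset : MeasurableSet (F ∩ {ω | σ ω < ⊤}) :=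
    (hσ.measurableSpace_le _ hF).inter (measurableSet_lt hσ.measurable' measurable_const)
  have hμ : ((M.P x).restrict (F ∩ {ω | σ ω < ⊤})).map (fun ω => M.postPath (σ ω) ω) =
      ((M.P x).restrict (F ∩ {ω | σ ω < ⊤})).bind fun ω => M.law (M.X ((σ ω).untopD 0) ω) := by
    refine Measure.ext fun S hS => ?_
    rw [Measure.map_apply hpost hS, Measure.bind_apply hS hlaw.aemeasurable,
      Measure.restrict_apply (hpost hS)]
    obtain ⟨A, hA, rfl⟩ := hS
    have h1 := M.strong_markov x σ hσ F hF A hA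
    rw [Set.inter_comm]
    refine Eq.trans ?_ (h1.trans ?_)
    · rfl
    · refine lintegral_congr fun ω => ?_
      exact (Measure.map_apply M.measurable_path (measurable_subtype_coe hA)).symm
  rw [← lintegral_map hH hpost, hμ, Measure.lintegral_bind hlaw.aemeasurable hH.aemeasurable]

/-- If the functional `H` of the path has mean at most `κ` from every point of `C`, and the process
is in `C` at the stopping time `σ`, then the mean of `H` of the path after `σ`, weighted by `V(σ)`,
is at most `κ` times the mean of `V(σ)`. -/
theorem setLIntegral_mul_postPath_le (x : E) {C : Set E} {σ : Ω → WithTop ℝ≥0}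
    (hσ : IsStoppingTime M.ℱ σ) (hσC : ∀ᵐ ω ∂M.P x, ∀ t : ℝ≥0, σ ω = t → M.X t ω ∈ C)
    {F : Set Ω} (hF : MeasurableSet[hσ.measurableSpace] F) {H : PathSpace E → ℝ≥0∞}
    (hH : Measurable H) {κ : ℝ≥0∞} (hκ : ∀ y ∈ C, ∫⁻ w, H w ∂M.law y ≤ κ)
    {V : ℝ≥0 → ℝ≥0∞} (hV : Measurable V) :
    ∫⁻ ω in F ∩ {ω | σ ω < ⊤}, V ((σ ω).untopD 0) * H (M.postPath (σ ω) ω) ∂M.P x ≤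
      κ * ∫⁻ ω in F ∩ {ω | σ ω < ⊤}, V ((σ ω).untopD 0) ∂M.P x := by
  have hpost := M.measurable_postPath hσ.measurable'
  have hVσ : Measurable[hσ.measurableSpace] fun ω => V ((σ ω).untopD 0) :=
    hV.comp (hσ.measurable.untopD 0)
  have hle := hσ.measurableSpace_le
  set μ := (M.P x).restrict (F ∩ {ω | σ ω < ⊤})
  have hHm : Measurable fun ω => H (M.postPath (σ ω) ω) := hH.comp hpost
  -- on the σ-algebra of events prior to `σ`, the density is at most `κ`
  have key : (μ.withDensity fun ω => H (M.postPath (σ ω) ω)).trim hle ≤ κ • μ.trim hle := by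
    refine Measure.le_iff.2 fun A hA => ?_
    rw [trim_measurableSet_eq hle hA, Measure.smul_apply, trim_measurableSet_eq hle hA,
      withDensity_apply _ (hle _ hA), Measure.restrict_restrict (hle _ hA), ← Set.inter_assoc,
      M.setLIntegral_postPath x hσ (hA.inter hF) hH,
      Measure.restrict_apply (hle _ hA), ← Set.inter_assoc, smul_eq_mul, ← setLIntegral_const]
    have hm : MeasurableSet (A ∩ F ∩ {ω | σ ω < ⊤}) :=
      (hle _ (hA.inter hF)).inter (measurableSet_lt hσ.measurable' measurable_const)
    refine setLIntegral_mono_ae' hm ?_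
    filter_upwards [hσC] with ω hω hωF
    exact hκ _ (hω _ (eq_coe_untopD hωF.2))
  calc ∫⁻ ω, V ((σ ω).untopD 0) * H (M.postPath (σ ω) ω) ∂μ
      = ∫⁻ ω, V ((σ ω).untopD 0) ∂(μ.withDensity fun ω => H (M.postPath (σ ω) ω)) := by
        rw [lintegral_withDensity_eq_lintegral_mul _ hHm (hVσ.mono hle le_rfl)]
        simp_rw [Pi.mul_apply, mul_comm]
    _ = ∫⁻ ω, V ((σ ω).untopD 0) ∂((μ.withDensity fun ω => H (M.postPath (σ ω) ω)).trim hle) :=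
        (lintegral_trim hle hVσ).symm
    _ ≤ ∫⁻ ω, V ((σ ω).untopD 0) ∂(κ • μ.trim hle) := lintegral_mono' key le_rfl
    _ = κ * ∫⁻ ω, V ((σ ω).untopD 0) ∂μ := by
        rw [lintegral_smul_measure, lintegral_trim hle hVσ, smul_eq_mul]

/-- The function of `ω` under the integral need not be measurable: here and in the sequel, upper
bounds for a modulated moment come from larger measurable functions, lower bounds from smaller
ones. -/
theorem modulatedMoment_eq (B : Set E) {f : E → ℝ} (hf : Measurable f) {r : ℝ≥0 → ℝ}
    (hr : Measurable r) (h : ℝ≥0) (x : E) :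
    M.modulatedMoment B f r h x = ∫⁻ ω, pathIntegral (fun t => ENNReal.ofReal (r t))
      (fun y => ENNReal.ofReal (f y)) (hittingAfter M.X B h ω) (fun t => M.X t ω) ∂M.P x := by
  unfold modulatedMoment pathIntegral
  refine lintegral_congr fun ω => ?_
  refine (setLIntegral_timeMeasure (G := fun u => ENNReal.ofReal (r u) *
    ENNReal.ofReal (f (M.X u ω))) ?_ (measurableSet_coe_le _)).symm
  have h1 : Measurable fun u : ℝ≥0 => M.X u ω :=
    measurable_pathSpace_eval_comp (w := fun _ => M.path ω) measurable_const measurable_id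
  exact hr.ennreal_ofReal.mul (hf.comp h1).ennreal_ofReal

end StrongMarkovFamily

/-! ### Almost sure hitting times and one cycle of the process -/

theorem isStoppingTime_add_coe {Ω : Type*} {m : MeasurableSpace Ω} {ℱ : Filtration ℝ≥0 m}
    {σ : Ω → WithTop ℝ≥0} (hσ : IsStoppingTime ℱ σ) (h : ℝ≥0) :
    IsStoppingTime ℱ fun ω => σ ω + h := by
  intro t
  by_cases ht : h ≤ t
  · have hset : {ω | σ ω + h ≤ t} = {ω | σ ω ≤ ((t - h : ℝ≥0) : WithTop ℝ≥0)} := by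
      ext ω
      simp only [Set.mem_ofPred_eq]
      induction σ ω using WithTop.recTopCoe with
      | top => exact iff_of_false (WithTop.coe_lt_top t).not_ge (WithTop.coe_lt_top _).not_ge
      | coe s =>
        rw [← WithTop.coe_add, WithTop.coe_le_coe, WithTop.coe_le_coe, le_tsub_iff_right ht]
    rw [hset]
    exact ℱ.mono tsub_le_self _ (hσ _)
  · have hset : {ω | σ ω + h ≤ t} = ∅ := by
      refine Set.eq_empty_of_forall_notMem fun ω hω => ht ?_
      exact WithTop.coe_le_coe.1 (le_trans le_add_self (show σ ω + h ≤ t from hω))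
    rw [hset]
    exact @MeasurableSet.empty _ (ℱ t)

theorem le_hittingAfter {E Ω : Type*} {X : ℝ≥0 → Ω → E} {C : Set E} {h : ℝ≥0} {ω : Ω}
    {T : WithTop ℝ≥0} (hT : ∀ t : ℝ≥0, h ≤ t → X t ω ∈ C → T ≤ t) : T ≤ hittingAfter X C h ω := by
  unfold hittingAfter
  split_ifs with hne
  · obtain ⟨j, hj, hjC⟩ := hne
    lift T to ℝ≥0 using ne_top_of_le_ne_top WithTop.coe_ne_top (hT j hj hjC)
    exact WithTop.coe_le_coe.2
      (le_csInf ⟨j, hj, hjC⟩ fun t ht => WithTop.coe_le_coe.1 (hT t ht.1 ht.2))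
  · exact le_top

theorem hittingAfter_le {E Ω : Type*} {X : ℝ≥0 → Ω → E} {C : Set E} {h : ℝ≥0} {ω : Ω}
    {T : WithTop ℝ≥0} (hT : h ≤ T) (hTC : ∀ t : ℝ≥0, T = t → X t ω ∈ C) :
    hittingAfter X C h ω ≤ T := by
  induction T using WithTop.recTopCoe with
  | top => exact le_top
  | coe t => exact hittingAfter_le_of_mem (WithTop.coe_le_coe.1 hT) (hTC t rfl)

theorem le_mul_pathIntegral {E : Type*} {V : ℝ≥0 → ℝ≥0∞} {f : E → ℝ} (hf_one : ∀ x, 1 ≤ f x) {c t : ℝ≥0} (w : ℝ≥0 → E)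
    (hc : V t ≤ c * ∫⁻ u in Set.Iic t, V u ∂timeMeasure) :
    V t ≤ c * pathIntegral V (fun z => ENNReal.ofReal (f z)) t w := by
  refine hc.trans (mul_le_mul_right ?_ _)
  unfold pathIntegral
  simp only [WithTop.coe_le_coe]
  refine lintegral_mono fun u => ?_
  calc V u = V u * 1 := (mul_one _).symm
    _ ≤ _ := by gcongr; exact ENNReal.one_le_ofReal.2 (hf_one _)

namespace StrongMarkovFamily

variable {E Ω : Type*} [MetricSpace E] [MeasurableSpace E] [BorelSpace E] [MeasurableSpace Ω]
  (M : StrongMarkovFamily E Ω)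

/-- `T` is a stopping time that is `P x`-almost surely the first time after `ρ` at which the
process is in `C`: it precedes all visits to `C` after `ρ`, and is almost surely a visit itself if
it is finite. -/
structure HitsAfter (x : E) (C : Set E) (ρ T : Ω → WithTop ℝ≥0) : Prop where
  isStoppingTime : IsStoppingTime M.ℱ T
  le : ∀ ω, ρ ω ≤ T ω
  le_of_mem : ∀ ω (t : ℝ≥0), ρ ω ≤ t → M.X t ω ∈ C → T ω ≤ t
  ae_mem : ∀ᵐ ω ∂M.P x, ∀ t : ℝ≥0, T ω = t → M.X t ω ∈ C

/-- `T` is a measurable functional of the path that does not exceed the first time after `h` at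
which the path is in `C`. -/
structure IsPathTime (C : Set E) (h : ℝ≥0) (T : PathSpace E → WithTop ℝ≥0) : Prop where
  measurable : Measurable T
  le : ∀ w, h ≤ T w
  le_of_mem : ∀ w (t : ℝ≥0), h ≤ t → w.1 t ∈ C → T w ≤ t

theorem exists_hitsAfter (x : E) {C : Set E} (hC : IsClosed C) {ρ : Ω → WithTop ℝ≥0}
    (hρ : IsStoppingTime M.ℱ ρ) : ∃ T, M.HitsAfter x C ρ T := by
  obtain ⟨T, h1, h2, h3, h4⟩ :=
    exists_isStoppingTime_hitting M.adapted M.right_continuous hC hρ (M.P x)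
  exact ⟨T, h1, h2, h3, h4⟩

/-- The first visit to `C` at least `h` after a stopping time `σ` is read off from the path after
`σ`. -/
theorem HitsAfter.exists_isPathTime {x : E} {C : Set E} (hC : IsClosed C)
    {σ σ' : Ω → WithTop ℝ≥0} (hσ : IsStoppingTime M.ℱ σ) {h : ℝ≥0}
    (hσ' : M.HitsAfter x C (fun ω => σ ω + h) σ') :
    ∃ T, IsPathTime C h T ∧
      ∀ᵐ ω ∂M.P x, σ ω < ⊤ → σ' ω = σ ω + T (M.postPath (σ ω) ω) := by
  have hpost := M.measurable_postPath hσ.measurable'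
  let 𝒢 : Filtration ℝ≥0 (inferInstance : MeasurableSpace (PathSpace E)) :=
    ⟨fun _ => inferInstance, fun _ _ _ => le_rfl, fun _ => le_rfl⟩
  obtain ⟨T, h1, h2, h3, h4⟩ := exists_isStoppingTime_hitting (ℱ := 𝒢)
    (X := fun t (w : PathSpace E) => w.1 t)
    (fun t => (measurable_pi_apply t).comp measurable_subtype_coe) (fun w => w.2) hC
    (isStoppingTime_const 𝒢 h) ((M.P x).map fun ω => M.postPath (σ ω) ω)
  refine ⟨T, ⟨h1.measurable', h2, fun w t ht => h3 w t (WithTop.coe_le_coe.2 ht)⟩, ?_⟩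
  filter_upwards [ae_of_ae_map hpost.aemeasurable h4, hσ'.ae_mem] with ω hT hσC hσt
  generalize hw : M.postPath (σ ω) ω = w at hT ⊢
  have hle := hσ'.le ω
  have hmem := hσ'.le_of_mem ω
  obtain ⟨s, hs⟩ : ∃ s : ℝ≥0, σ ω = s := ⟨_, eq_coe_untopD hσt⟩
  have hwX : ∀ t, w.1 t = M.X (s + t) ω := fun t => by rw [← hw, hs]; rfl
  rw [hs] at hle hmem ⊢
  have h5 := h2 w
  have h6 := h3 w
  apply le_antisymm
  · induction hTw : T w using WithTop.recTopCoe with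
    | top => exact le_top
    | coe t =>
      rw [hTw] at h5
      refine hmem (s + t) (add_le_add_right h5 _) ?_
      rw [← hwX]
      exact hT t hTw
  · induction hTσ : σ' ω using WithTop.recTopCoe with
    | top => exact le_top
    | coe t =>
      rw [hTσ, ← WithTop.coe_add, WithTop.coe_le_coe] at hle
      have h7 : s ≤ t := le_self_add.trans hle
      have h8 : T w ≤ ((t - s : ℝ≥0) : WithTop ℝ≥0) := by
        refine h6 _ (WithTop.coe_le_coe.2 (le_tsub_of_add_le_left hle)) ?_
        rw [hwX, add_tsub_cancel_of_le h7]
        exact hσC t hTσ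
      refine (add_le_add_right h8 _).trans ?_
      rw [← WithTop.coe_add, add_tsub_cancel_of_le h7]

/-- Submultiplicativity bounds a weighted integral of the path after time `a` by the weight at `a`
times an integral of the shifted path. -/
theorem setLIntegral_segment_le {V : ℝ≥0 → ℝ≥0∞} (hV : IsTameWeight V) {g : E → ℝ≥0∞}
    (hg : Measurable g) (a : ℝ≥0) (τ : WithTop ℝ≥0) (ω : Ω) :
    ∫⁻ u in {u : ℝ≥0 | (a : WithTop ℝ≥0) < u ∧ (u : WithTop ℝ≥0) ≤ a + τ},
        V u * g (M.X u ω) ∂timeMeasure ≤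
      V a * pathIntegral V g τ (M.postPath a ω).1 := by
  have hX : Measurable fun u : ℝ≥0 => M.X u ω :=
    measurable_pathSpace_eval_comp (w := fun _ => M.path ω) measurable_const measurable_id
  have hm : Measurable fun u => V u * g (M.X u ω) := hV.measurable.mul (hg.comp hX)
  rw [setLIntegral_timeMeasure_shift hm a
    (show MeasurableSet {u : ℝ≥0 | (a : WithTop ℝ≥0) < u ∧ (u : WithTop ℝ≥0) ≤ a + τ} from
      (measurableSet_lt measurable_const WithTop.measurable_coe).inter (measurableSet_coe_le _))
    fun u hu => (WithTop.coe_lt_coe.1 hu.1).le]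
  have hX' : Measurable fun u : ℝ≥0 => M.X (a + u) ω := hX.comp (measurable_const.add measurable_id)
  unfold pathIntegral
  rw [← lintegral_const_mul (f := fun u => V u * g ((M.postPath a ω).1 u)) _
    (hV.measurable.mul (hg.comp hX'))]
  refine (lintegral_mono_set (t := {u : ℝ≥0 | (u : WithTop ℝ≥0) ≤ τ}) fun u hu => ?_).trans
    (lintegral_mono fun u => ?_)
  · have h2 : ((a + u : ℝ≥0) : WithTop ℝ≥0) ≤ a + τ := hu.2
    rw [WithTop.coe_add] at h2
    exact (WithTop.add_le_add_iff_left WithTop.coe_ne_top).1 h2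
  · change V (a + u) * g (M.X (a + u) ω) ≤ V a * (V u * g (M.X (a + u) ω))
    rw [← mul_assoc]
    exact mul_le_mul_left (hV.add_le a u) _


variable {M} {f : E → ℝ} {r : ℝ≥0 → ℝ} {V : ℝ≥0 → ℝ≥0∞} {c₁ c₂ : ℝ≥0} {C : Set E}

theorem IsPathTime.lintegral_pathIntegral_le (hf : Measurable f) (hc : IsComparable r V c₁ c₂)
    {h : ℝ≥0} {T : PathSpace E → WithTop ℝ≥0} (hT : IsPathTime C h T) (y : E) :
    ∫⁻ w, pathIntegral V (fun z => ENNReal.ofReal (f z)) (T w) w.1 ∂M.law y ≤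
      c₁ * M.modulatedMoment C f r h y := by
  rw [M.lintegral_law y (measurable_pathIntegral hc.tame.measurable hf.ennreal_ofReal
      (w := fun w => w) measurable_id hT.measurable), M.modulatedMoment_eq C hf hc.measurable,
    ← lintegral_const_mul' _ _ ENNReal.coe_ne_top]
  refine lintegral_mono fun ω => ?_
  rw [← pathIntegral_const_mul]
  exact pathIntegral_mono hc.le_rate (le_hittingAfter (hT.le_of_mem (M.path ω)))

/-- The lower integral that defines the modulated moment dominates the integral up to a stopping
time that precedes the visits to `C`. -/
theorem HitsAfter.pathIntegral_le (hf : Measurable f) (hr : Measurable r) {x : E} {h : ℝ≥0}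
    {T : Ω → WithTop ℝ≥0} (hT : M.HitsAfter x C (fun _ => h) T) :
    ∫⁻ ω, pathIntegral (fun t => ENNReal.ofReal (r t)) (fun z => ENNReal.ofReal (f z)) (T ω)
      (fun t => M.X t ω) ∂M.P x ≤ M.modulatedMoment C f r h x := by
  rw [M.modulatedMoment_eq C hf hr]
  exact lintegral_mono fun ω => pathIntegral_mono (fun _ => le_rfl)
    (le_hittingAfter fun t ht => hT.le_of_mem ω t (WithTop.coe_le_coe.2 ht))

theorem HitsAfter.weight_le (hf : Measurable f) (hf_one : ∀ x, 1 ≤ f x)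
    (hc : IsComparable r V c₁ c₂) {x : E} {h : ℝ≥0} {T : Ω → WithTop ℝ≥0}
    (hT : M.HitsAfter x C (fun _ => h) T) {c : ℝ≥0}
    (hcV : ∀ t ≥ h, V t ≤ c * ∫⁻ u in Set.Iic t, V u ∂timeMeasure) :
    ∫⁻ ω in {ω | T ω < ⊤}, V ((T ω).untopD 0) ∂M.P x ≤
      c * c₁ * M.modulatedMoment C f r h x := by
  calc ∫⁻ ω in {ω | T ω < ⊤}, V ((T ω).untopD 0) ∂M.P x
      ≤ ∫⁻ ω in {ω | T ω < ⊤}, ((c * c₁ : ℝ≥0) : ℝ≥0∞) * pathIntegral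
        (fun t => ENNReal.ofReal (r t)) (fun z => ENNReal.ofReal (f z)) (T ω)
          (fun t => M.X t ω) ∂M.P x := by
        refine setLIntegral_mono' (measurableSet_lt hT.isStoppingTime.measurable' measurable_const)
          fun ω hω => ?_
        have hle := hT.le ω
        obtain ⟨s, hs⟩ : ∃ s : ℝ≥0, T ω = s := ⟨_, eq_coe_untopD hω⟩
        rw [hs] at hle ⊢
        rw [ENNReal.coe_mul, mul_assoc, ← pathIntegral_const_mul]
        refine (le_mul_pathIntegral hf_one (fun t => M.X t ω)
          (hcV s (WithTop.coe_le_coe.1 hle))).trans (mul_le_mul_right ?_ _)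
        exact pathIntegral_mono hc.le_rate le_rfl
    _ ≤ ∫⁻ ω, ((c * c₁ : ℝ≥0) : ℝ≥0∞) * pathIntegral
        (fun t => ENNReal.ofReal (r t)) (fun z => ENNReal.ofReal (f z)) (T ω)
          (fun t => M.X t ω) ∂M.P x := setLIntegral_le_lintegral _ _
    _ ≤ c * c₁ * M.modulatedMoment C f r h x := by
        rw [lintegral_const_mul' _ _ ENNReal.coe_ne_top, ENNReal.coe_mul]
        exact mul_le_mul_right (hT.pathIntegral_le hf hc.measurable) _

/-- During one cycle, the modulated moment is at most a constant times the weight at the start of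
the cycle. -/
theorem HitsAfter.setLIntegral_segment_le (hf : Measurable f) (hc : IsComparable r V c₁ c₂)
    (hC : IsClosed C) {x : E} {σ σ' : Ω → WithTop ℝ≥0} (hσ : IsStoppingTime M.ℱ σ)
    (hσC : ∀ᵐ ω ∂M.P x, ∀ t : ℝ≥0, σ ω = t → M.X t ω ∈ C) {h : ℝ≥0}
    (hσ' : M.HitsAfter x C (fun ω => σ ω + h) σ') {K : ℝ≥0∞}
    (hK : ∀ y ∈ C, M.modulatedMoment C f r h y ≤ K) {F : Set Ω}
    (hF : MeasurableSet[hσ.measurableSpace] F) :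
    ∫⁻ ω in F ∩ {ω | σ ω < ⊤}, (∫⁻ u in {u : ℝ≥0 | σ ω < u ∧ (u : WithTop ℝ≥0) ≤ σ' ω},
        ENNReal.ofReal (r u) * ENNReal.ofReal (f (M.X u ω)) ∂timeMeasure) ∂M.P x ≤
      c₂ * (c₁ * K * ∫⁻ ω in F ∩ {ω | σ ω < ⊤}, V ((σ ω).untopD 0) ∂M.P x) := by
  obtain ⟨T, hT, hσT⟩ := HitsAfter.exists_isPathTime M hC hσ hσ'
  refine le_trans ?_ (mul_le_mul_right (M.setLIntegral_mul_postPath_le x hσ hσC hF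
    (measurable_pathIntegral hc.tame.measurable hf.ennreal_ofReal measurable_id hT.measurable)
    (fun y hy => (hT.lintegral_pathIntegral_le hf hc y).trans (mul_le_mul_right (hK y hy) _))
    hc.tame.measurable) c₂)
  rw [← lintegral_const_mul' _ _ ENNReal.coe_ne_top]
  have hm : MeasurableSet (F ∩ {ω | σ ω < ⊤}) :=
    (hσ.measurableSpace_le _ hF).inter (measurableSet_lt hσ.measurable' measurable_const)
  refine setLIntegral_mono_ae' hm ?_
  filter_upwards [hσT] with ω hω hωF
  rw [hω hωF.2]
  obtain ⟨s, hs⟩ : ∃ s : ℝ≥0, σ ω = s := ⟨_, eq_coe_untopD hωF.2⟩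
  rw [hs]
  refine le_trans ?_ (mul_le_mul_right (M.setLIntegral_segment_le hc.tame hf.ennreal_ofReal s _ ω) _)
  rw [← lintegral_const_mul' _ _ ENNReal.coe_ne_top]
  refine lintegral_mono fun u => ?_
  rw [← mul_assoc]
  exact mul_le_mul_left (hc.rate_le u) _

/-- A pointwise bound on the growth of the weight over a cycle, in terms of the path after the
start of the cycle, integrates to a bound in mean. -/
theorem setLIntegral_weight_le_of_forall {x : E} {σ σ' : Ω → WithTop ℝ≥0}
    (hσ : IsStoppingTime M.ℱ σ)
    (hσC : ∀ᵐ ω ∂M.P x, ∀ t : ℝ≥0, σ ω = t → M.X t ω ∈ C) (hV : Measurable V)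
    {T : PathSpace E → WithTop ℝ≥0}
    (hσT : ∀ᵐ ω ∂M.P x, σ ω < ⊤ → σ' ω = σ ω + T (M.postPath (σ ω) ω)) {F F' : Set Ω}
    (hF : MeasurableSet[hσ.measurableSpace] F) (hF' : MeasurableSet F') (hsub : F' ⊆ F)
    (hσ' : Measurable σ') (hle : ∀ ω, σ ω ≤ σ' ω)
    {H : PathSpace E → ℝ≥0∞} (hH : Measurable H) {κ : ℝ≥0∞}
    (hκ : ∀ y ∈ C, ∫⁻ w, H w ∂M.law y ≤ κ)
    (hbound : ∀ ω ∈ F', ∀ s t : ℝ≥0, σ ω = s → T (M.postPath s ω) = t → σ' ω = (s + t : ℝ≥0) →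
      V (s + t) ≤ V s * H (M.postPath s ω)) :
    ∫⁻ ω in F' ∩ {ω | σ' ω < ⊤}, V ((σ' ω).untopD 0) ∂M.P x ≤
      κ * ∫⁻ ω in F ∩ {ω | σ ω < ⊤}, V ((σ ω).untopD 0) ∂M.P x := by
  refine le_trans ?_ (M.setLIntegral_mul_postPath_le x hσ hσC hF hH hκ hV)
  refine le_trans ?_ (lintegral_mono_set (s := F' ∩ {ω | σ' ω < ⊤})
    fun ω hω => ⟨hsub hω.1, (hle ω).trans_lt hω.2⟩)
  refine setLIntegral_mono_ae' (hF'.inter (measurableSet_lt hσ' measurable_const)) ?_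
  filter_upwards [hσT] with ω hω hωF
  have hlt : σ ω < ⊤ := (hle ω).trans_lt hωF.2
  obtain ⟨s, hs⟩ : ∃ s : ℝ≥0, σ ω = s := ⟨_, eq_coe_untopD hlt⟩
  have h1 := hω hlt
  have h2 : σ' ω < ⊤ := hωF.2
  rw [h1, hs] at h2
  obtain ⟨t, ht⟩ : ∃ t : ℝ≥0, T (M.postPath s ω) = t :=
    ⟨_, eq_coe_untopD ((WithTop.add_lt_top.1 h2).2)⟩
  rw [hs, ht, ← WithTop.coe_add] at h1
  have h3 := hbound ω hωF.1 s t hs ht h1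
  rw [h1, hs]
  exact h3

/-- The mean of the weight grows by at most a constant factor over a cycle. -/
theorem HitsAfter.setLIntegral_weight_le (hf : Measurable f) (hf_one : ∀ x, 1 ≤ f x)
    (hc : IsComparable r V c₁ c₂) (hC : IsClosed C) {x : E} {σ σ' : Ω → WithTop ℝ≥0}
    (hσ : IsStoppingTime M.ℱ σ)
    (hσC : ∀ᵐ ω ∂M.P x, ∀ t : ℝ≥0, σ ω = t → M.X t ω ∈ C) {h : ℝ≥0}
    (hσ' : M.HitsAfter x C (fun ω => σ ω + h) σ') {K : ℝ≥0∞}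
    (hK : ∀ y ∈ C, M.modulatedMoment C f r h y ≤ K) {c : ℝ≥0}
    (hcV : ∀ t ≥ h, V t ≤ c * ∫⁻ u in Set.Iic t, V u ∂timeMeasure) {F F' : Set Ω}
    (hF : MeasurableSet[hσ.measurableSpace] F) (hF' : MeasurableSet F') (hsub : F' ⊆ F) :
    ∫⁻ ω in F' ∩ {ω | σ' ω < ⊤}, V ((σ' ω).untopD 0) ∂M.P x ≤
      c * (c₁ * K) * ∫⁻ ω in F ∩ {ω | σ ω < ⊤}, V ((σ ω).untopD 0) ∂M.P x := by
  obtain ⟨T, hT, hσT⟩ := HitsAfter.exists_isPathTime M hC hσ hσ'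
  have hm := measurable_pathIntegral hc.tame.measurable hf.ennreal_ofReal
    (measurable_id (α := PathSpace E)) hT.measurable
  refine setLIntegral_weight_le_of_forall hσ hσC hc.tame.measurable hσT hF hF' hsub
    hσ'.isStoppingTime.measurable' (fun ω => le_self_add.trans (hσ'.le ω))
    (H := fun w => c * pathIntegral V (fun z => ENNReal.ofReal (f z)) (T w) w.1)
    (hm.const_mul _) (fun y hy => ?_) fun ω _ s t _ ht _ => ?_
  · rw [lintegral_const_mul' _ _ ENNReal.coe_ne_top]
    exact mul_le_mul_right ((hT.lintegral_pathIntegral_le hf hc y).trans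
      (mul_le_mul_right (hK y hy) _)) _
  · refine (hc.tame.add_le s t).trans (mul_le_mul_right ?_ _)
    have h1 := hT.le (M.postPath s ω)
    rw [ht] at h1 ⊢
    exact le_mul_pathIntegral hf_one _ (hcV t (WithTop.coe_le_coe.1 h1))

/-- Over a cycle that starts late enough, the mean of the weight on the event that the functional
`O` of the path vanishes grows by a factor close to the probability of this event: the weight is
nearly constant over cycles shorter than `T₁`, and longer cycles contribute little. -/
theorem HitsAfter.setLIntegral_weight_le_of_slow (hf : Measurable f) (hf_one : ∀ x, 1 ≤ f x)
    (hc : IsComparable r V c₁ c₂) (hC : IsClosed C) {x : E} {σ σ' : Ω → WithTop ℝ≥0}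
    (hσ : IsStoppingTime M.ℱ σ)
    (hσC : ∀ᵐ ω ∂M.P x, ∀ t : ℝ≥0, σ ω = t → M.X t ω ∈ C) {h : ℝ≥0}
    (hσ' : M.HitsAfter x C (fun ω => σ ω + h) σ') {K : ℝ≥0∞}
    (hK : ∀ y ∈ C, M.modulatedMoment C f r h y ≤ K) {θ η T₁ S q : ℝ≥0}
    (hη : ∀ t ≥ T₁, V t ≤ η * ∫⁻ u in Set.Iic t, V u ∂timeMeasure)
    (hθ : ∀ s ≥ S, ∀ u ≤ T₁, V (s + u) ≤ θ * V s) (hS : ∀ ω, S ≤ σ ω)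
    {O : PathSpace E → ℝ≥0∞} (hO : Measurable O) (hq : ∀ y ∈ C, M.law y {w | O w = 0} ≤ q)
    {F F' : Set Ω}
    (hF : MeasurableSet[hσ.measurableSpace] F) (hF' : MeasurableSet F') (hsub : F' ⊆ F)
    (hF'O : ∀ ω ∈ F', σ' ω < ⊤ → O (M.postPath (σ ω) ω) = 0) :
    ∫⁻ ω in F' ∩ {ω | σ' ω < ⊤}, V ((σ' ω).untopD 0) ∂M.P x ≤
      (θ * q + η * (c₁ * K)) * ∫⁻ ω in F ∩ {ω | σ ω < ⊤}, V ((σ ω).untopD 0) ∂M.P x := by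
  obtain ⟨T, hT, hσT⟩ := HitsAfter.exists_isPathTime M hC hσ hσ'
  have hm := measurable_pathIntegral hc.tame.measurable hf.ennreal_ofReal
    (measurable_id (α := PathSpace E)) hT.measurable
  have hO0 : MeasurableSet {w | O w = 0} := hO (measurableSet_singleton 0)
  have hind : Measurable fun w => (θ : ℝ≥0∞) * {w | O w = 0}.indicator 1 w :=
    (measurable_one.indicator hO0).const_mul _
  refine setLIntegral_weight_le_of_forall hσ hσC hc.tame.measurable hσT hF hF' hsub
    hσ'.isStoppingTime.measurable' (fun ω => le_self_add.trans (hσ'.le ω))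
    (H := fun w => θ * {w | O w = 0}.indicator 1 w +
      η * pathIntegral V (fun z => ENNReal.ofReal (f z)) (T w) w.1)
    (hind.add (hm.const_mul _)) (fun y hy => ?_) fun ω hω s t hs ht hst => ?_
  · rw [lintegral_add_left hind, lintegral_const_mul' _ _ ENNReal.coe_ne_top,
      lintegral_const_mul' _ _ ENNReal.coe_ne_top, lintegral_indicator_one hO0]
    gcongr
    · exact hq y hy
    · exact (hT.lintegral_pathIntegral_le hf hc y).trans (mul_le_mul_right (hK y hy) _)
  · rcases le_total t T₁ with htT | htT
    · have h0 := hF'O ω hω (by rw [hst]; exact WithTop.coe_lt_top _)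
      have h1 := hS ω
      rw [hs] at h0 h1
      rw [Set.indicator_of_mem (show M.postPath s ω ∈ {w | O w = 0} from h0), Pi.one_apply, mul_one,
        mul_comm]
      exact (hθ s (WithTop.coe_le_coe.1 h1) t htT).trans (mul_le_mul_left le_self_add _)
    · refine (hc.tame.add_le s t).trans (mul_le_mul_right ?_ _)
      rw [ht]
      exact (le_mul_pathIntegral hf_one _ (hη t htT)).trans le_add_self

end StrongMarkovFamily

/-! ### Excursions between visits to a petite set -/

namespace StrongMarkovFamily

variable {E Ω : Type*} [MetricSpace E] [MeasurableSpace E] [BorelSpace E] [MeasurableSpace Ω]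
  {M : StrongMarkovFamily E Ω} {f : E → ℝ} {r : ℝ≥0 → ℝ} {V : ℝ≥0 → ℝ≥0∞} {c₁ c₂ : ℝ≥0}
  {C : Set E}

theorem modulatedMoment_le_of_ae_mem (hf : Measurable f) (hr : Measurable r) {B : Set E} {x : E}
    {h : ℝ≥0} {ζ : Ω → WithTop ℝ≥0} (hζ : ∀ ω, h ≤ ζ ω)
    (hζB : ∀ᵐ ω ∂M.P x, ∀ t : ℝ≥0, ζ ω = t → M.X t ω ∈ B) :
    M.modulatedMoment B f r h x ≤ ∫⁻ ω, pathIntegral (fun t => ENNReal.ofReal (r t))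
      (fun z => ENNReal.ofReal (f z)) (ζ ω) (fun t => M.X t ω) ∂M.P x := by
  rw [M.modulatedMoment_eq B hf hr]
  refine lintegral_mono_ae ?_
  filter_upwards [hζB] with ω hω
  exact pathIntegral_mono (fun _ => le_rfl) (hittingAfter_le (hζ ω) hω)

theorem modulatedMoment_mono (hf : Measurable f) (hr : Measurable r) {h h' : ℝ≥0} (hh : h ≤ h')
    (x : E) : M.modulatedMoment C f r h x ≤ M.modulatedMoment C f r h' x := by
  rw [M.modulatedMoment_eq C hf hr, M.modulatedMoment_eq C hf hr]
  exact lintegral_mono fun ω => pathIntegral_mono (fun _ => le_rfl)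
    (le_hittingAfter fun t ht htC => hittingAfter_le_of_mem (hh.trans ht) htC)

/-- A visit to `C` after time `a + b` is provided by waiting for a visit after `a`, and then for
another one at least `b` later. -/
theorem modulatedMoment_add_le (hf : Measurable f) (hf_one : ∀ x, 1 ≤ f x)
    (hc : IsComparable r V c₁ c₂) (hC : IsClosed C) {a b : ℝ≥0} {K : ℝ≥0∞}
    (hK : ∀ y ∈ C, M.modulatedMoment C f r b y ≤ K) {c : ℝ≥0}
    (hcV : ∀ t ≥ a, V t ≤ c * ∫⁻ u in Set.Iic t, V u ∂timeMeasure) (x : E) :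
    M.modulatedMoment C f r (a + b) x ≤
      (1 + c₂ * (c₁ * K * (c * c₁))) * M.modulatedMoment C f r a x := by
  obtain ⟨σ, hσ⟩ := M.exists_hitsAfter x hC (isStoppingTime_const M.ℱ a)
  obtain ⟨σ', hσ'⟩ := M.exists_hitsAfter x hC (isStoppingTime_add_coe hσ.isStoppingTime b)
  have hσmeas := hσ.isStoppingTime.measurable'
  have hset : MeasurableSet {ω | σ ω < ⊤} := measurableSet_lt hσmeas measurable_const
  have hr' := hc.measurable.ennreal_ofReal
  have hm : Measurable fun ω => pathIntegral (fun t => ENNReal.ofReal (r t))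
      (fun z => ENNReal.ofReal (f z)) (σ ω) (fun t => M.X t ω) :=
    measurable_pathIntegral hr' hf.ennreal_ofReal M.measurable_path hσmeas
  refine (modulatedMoment_le_of_ae_mem hf hc.measurable (ζ := σ') (fun ω => ?_)
    hσ'.ae_mem).trans ?_
  · exact (add_le_add_left (hσ.le ω) _).trans (hσ'.le ω)
  calc _ ≤ ∫⁻ ω, (pathIntegral (fun t => ENNReal.ofReal (r t)) (fun z => ENNReal.ofReal (f z))
          (σ ω) (fun t => M.X t ω) + {ω | σ ω < ⊤}.indicator (fun ω =>
          ∫⁻ u in {u : ℝ≥0 | σ ω < u ∧ (u : WithTop ℝ≥0) ≤ σ' ω},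
        ENNReal.ofReal (r u) * ENNReal.ofReal (f (M.X u ω)) ∂timeMeasure) ω) ∂M.P x := by
        refine lintegral_mono fun ω => ?_
        by_cases hω : σ ω < ⊤
        · rw [Set.indicator_of_mem (show ω ∈ {ω | σ ω < ⊤} from hω)]
          refine le_trans (lintegral_mono_set fun u hu => ?_) (lintegral_union_le _ _ _)
          exact (le_or_gt (u : WithTop ℝ≥0) (σ ω)).imp id fun h => ⟨h, hu⟩
        · refine le_add_right (pathIntegral_mono (fun _ => le_rfl) ?_)
          rw [not_lt_top_iff.1 hω]
          exact le_top
    _ ≤ M.modulatedMoment C f r a x + c₂ * (c₁ * K * (c * c₁ * M.modulatedMoment C f r a x)) := by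
        rw [lintegral_add_left hm, lintegral_indicator hset]
        refine add_le_add (hσ.pathIntegral_le hf hc.measurable) ?_
        have h1 := HitsAfter.setLIntegral_segment_le hf hc hC hσ.isStoppingTime hσ.ae_mem hσ' hK
          (F := Set.univ) MeasurableSet.univ
        rw [Set.univ_inter] at h1
        refine h1.trans ?_
        gcongr
        exact hσ.weight_le hf hf_one hc hcV
    _ = _ := by ring

/-- The moments of the return times to `C` with different delays are comparable. -/
theorem exists_modulatedMoment_le_mul (hf : Measurable f) (hf_one : ∀ x, 1 ≤ f x)
    (hc : IsComparable r V c₁ c₂) (hC : IsClosed C) {δ : ℝ≥0} (hδ : 0 < δ)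
    (hK : (⨆ x ∈ C, M.modulatedMoment C f r δ x) < ⊤) (h : ℝ≥0) :
    ∃ c : ℝ≥0, ∀ x, M.modulatedMoment C f r h x ≤ c * M.modulatedMoment C f r δ x := by
  have key : ∀ n : ℕ, ∃ c : ℝ≥0, ∀ x,
      M.modulatedMoment C f r ((n + 1) * δ) x ≤ c * M.modulatedMoment C f r δ x := by
    intro n
    induction n with
    | zero => exact ⟨1, fun x => by simp⟩
    | succ n ih =>
      obtain ⟨c, hcn⟩ := ih
      obtain ⟨c', hc'⟩ := hc.tame.le_integral ((n + 1) * δ) (by positivity)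
      lift (⨆ x ∈ C, M.modulatedMoment C f r δ x) to ℝ≥0 using hK.ne with K hKeq
      refine ⟨(1 + c₂ * (c₁ * K * (c' * c₁))) * c, fun x => ?_⟩
      have h1 := modulatedMoment_add_le hf hf_one hc hC (a := (n + 1) * δ) (b := δ) (K := K)
        (fun y hy => by rw [hKeq]; exact le_iSup₂_of_le y hy le_rfl) hc' x
      rw [show ((n + 1 : ℕ) + 1 : ℝ≥0) * δ = (n + 1) * δ + δ by push_cast; ring]
      refine h1.trans ((mul_le_mul_right (hcn x) _).trans (le_of_eq ?_))
      push_cast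
      ring
  obtain ⟨n, hn⟩ := exists_nat_gt (h / δ)
  obtain ⟨c, hc'⟩ := key n
  refine ⟨c, fun x => (modulatedMoment_mono hf hc.measurable ?_ x).trans (hc' x)⟩
  rw [div_lt_iff₀ hδ] at hn
  refine hn.le.trans ?_
  gcongr
  exact le_self_add

theorem exists_modulatedMoment_iSup_le (hf : Measurable f) (hf_one : ∀ x, 1 ≤ f x)
    (hc : IsComparable r V c₁ c₂) (hC : IsClosed C) {δ : ℝ≥0} (hδ : 0 < δ)
    (hK : (⨆ x ∈ C, M.modulatedMoment C f r δ x) < ⊤) (h : ℝ≥0) :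
    (⨆ x ∈ C, M.modulatedMoment C f r h x) < ⊤ := by
  obtain ⟨c, hc'⟩ := exists_modulatedMoment_le_mul hf hf_one hc hC hδ hK h
  refine (iSup₂_le fun x hx => (hc' x).trans (mul_le_mul_right (le_iSup₂ (f := fun x (_ : x ∈ C) =>
    M.modulatedMoment C f r δ x) x hx) _)).trans_lt (ENNReal.mul_lt_top ENNReal.coe_lt_top hK)

/-! ### Visits to an accessible set from a petite set -/

theorem pathIntegral_postPath_le {B : Set E} (hB : MeasurableSet B) {n t p : ℝ≥0} (htp : t ≤ p)
    (ω : Ω) : pathIntegral 1 (B.indicator 1) n (M.postPath t ω).1 ≤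
      pathIntegral 1 (B.indicator 1) (n + p : ℝ≥0) (M.path ω).1 := by
  have hX : Measurable fun u : ℝ≥0 => M.X u ω :=
    measurable_pathSpace_eval_comp (w := fun _ => M.path ω) measurable_const measurable_id
  have hm : Measurable fun u => (1 : ℝ≥0 → ℝ≥0∞) u * B.indicator 1 (M.X u ω) :=
    measurable_one.mul ((measurable_one.indicator hB).comp hX)
  unfold pathIntegral
  simp only [WithTop.coe_le_coe]
  calc _ = ∫⁻ u in Set.Icc t (t + n), (1 : ℝ≥0 → ℝ≥0∞) u * B.indicator 1 (M.X u ω)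
        ∂timeMeasure := by
        rw [setLIntegral_timeMeasure_shift hm t measurableSet_Icc Set.Icc_subset_Ici_self]
        have hset : {u : ℝ≥0 | u ≤ n} = {u | t + u ∈ Set.Icc t (t + n)} := by
          ext u; simp
        rw [hset]
        rfl
    _ ≤ _ := lintegral_mono_set fun u hu => hu.2.trans (by rw [add_comm]; gcongr)

theorem exists_pathIntegral_pos {B : Set E} (hB : MeasurableSet B) {x : E}
    (hx : 0 < M.occupation x B) :
    ∃ n : ℕ, 0 < ∫⁻ w, pathIntegral 1 (B.indicator 1) (n : ℝ≥0) w.1 ∂M.law x := by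
  by_contra! hcon
  refine hx.ne' ?_
  have hm : ∀ n : ℕ, Measurable fun w : PathSpace E =>
      pathIntegral 1 (B.indicator 1) (n : ℝ≥0) w.1 := fun n =>
    measurable_pathIntegral measurable_one (measurable_one.indicator hB) measurable_id
      measurable_const
  have h0 : ∀ n : ℕ, ∀ᵐ ω ∂M.P x,
      pathIntegral 1 (B.indicator 1) (n : ℝ≥0) (M.path ω).1 = 0 := fun n => by
    have h1 := le_antisymm (hcon n) zero_le
    rw [M.lintegral_law x (hm n), lintegral_eq_zero_iff
      (f := fun ω => pathIntegral 1 (B.indicator 1) (n : ℝ≥0) (M.path ω).1)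
      ((hm n).comp M.measurable_path)] at h1
    exact h1
  unfold occupation
  refine (lintegral_eq_zero_of_ae_eq_zero ?_)
  filter_upwards [ae_all_iff.2 h0] with ω hω
  have hX : Measurable fun u : ℝ≥0 => M.X u ω :=
    measurable_pathSpace_eval_comp (w := fun _ => M.path ω) measurable_const measurable_id
  rw [← lintegral_timeMeasure (G := fun u => B.indicator 1 (M.X u ω))
    ((measurable_one.indicator hB).comp hX)]
  have huniv : (⋃ n : ℕ, {u : ℝ≥0 | (u : WithTop ℝ≥0) ≤ (n : ℝ≥0)}) = Set.univ := by
    refine Set.eq_univ_of_forall fun u => ?_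
    obtain ⟨n, hn⟩ := exists_nat_ge u
    exact Set.mem_iUnion.2 ⟨n, WithTop.coe_le_coe.2 hn⟩
  rw [← setLIntegral_univ, ← huniv]
  refine le_antisymm ((lintegral_iUnion_le _ _).trans (le_of_eq ?_)) zero_le
  refine ENNReal.tsum_eq_zero.2 fun n => ?_
  rw [← hω n]
  unfold pathIntegral
  simp only [Pi.one_apply, one_mul]
  rfl

/-- From every point of a petite set, an accessible set is visited before a fixed time with a
probability bounded away from zero, and even for a set of times of positive measure. -/
theorem IsPetite.exists_law_le (hC : M.IsPetite C) {B : Set E} (hB : MeasurableSet B)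
    (hocc : ∀ x, 0 < M.occupation x B) :
    ∃ L q : ℝ≥0, q < 1 ∧
      ∀ y ∈ C, M.law y {w | pathIntegral 1 (B.indicator 1) L w.1 = 0} ≤ q := by
  obtain ⟨-, a, ν, ha, -, hν0, hν⟩ := hC
  have hm : ∀ L : ℝ≥0, Measurable fun w : PathSpace E =>
      pathIntegral 1 (B.indicator 1) L w.1 := fun n =>
    measurable_pathIntegral measurable_one (measurable_one.indicator hB) measurable_id
      measurable_const
  let φ : ℕ → E → ℝ≥0∞ := fun n y =>
    ∫⁻ w, pathIntegral 1 (B.indicator 1) (n : ℝ≥0) w.1 ∂M.law y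
  have hφ : ∀ n, Measurable (φ n) := fun n =>
    (Measure.measurable_lintegral (hm n)).comp M.measurable_law'
  -- some set on which the expected occupation of `B` is bounded below is charged by `ν`
  obtain ⟨⟨n, k⟩, hnk⟩ : ∃ p : ℕ × ℕ, ν {y | (p.2 : ℝ≥0∞)⁻¹ < φ p.1 y} ≠ 0 := by
    by_contra! hcon
    refine hν0 (Measure.measure_univ_eq_zero.1 ?_)
    rw [← Set.eq_univ_of_forall (s := ⋃ p : ℕ × ℕ, {y | (p.2 : ℝ≥0∞)⁻¹ < φ p.1 y}) fun y => ?_]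
    · exact measure_iUnion_null hcon
    · obtain ⟨n, hn⟩ := exists_pathIntegral_pos hB (hocc y)
      obtain ⟨k, hk⟩ := ENNReal.exists_inv_nat_lt hn.ne'
      exact Set.mem_iUnion.2 ⟨(n, k), hk⟩
  set A := {y | (k : ℝ≥0∞)⁻¹ < φ n y} with hA
  have hAm : MeasurableSet A := measurableSet_lt measurable_const (hφ n)
  set v : ℝ≥0∞ := (k : ℝ≥0∞)⁻¹ * min (ν A) 1
  have hv0 : v ≠ 0 := mul_ne_zero (ENNReal.inv_ne_zero.2 (ENNReal.natCast_ne_top k))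
    (by simp [hnk])
  have hle : ∀ p : ℝ≥0, ∀ y ∈ C, v ≤ (∫⁻ w, pathIntegral 1 (B.indicator 1) (n + p : ℝ≥0) w.1
      ∂M.law y) + n * a (Set.Ioi p) := fun p y hy => by
    calc v ≤ (k : ℝ≥0∞)⁻¹ * ν A := mul_le_mul_right (min_le_left _ _) _
      _ ≤ (k : ℝ≥0∞)⁻¹ * ∫⁻ t, M.transition t y A ∂a := mul_le_mul_right (hν y hy A hAm) _
      _ ≤ ∫⁻ t, (k : ℝ≥0∞)⁻¹ * M.transition t y A ∂a := lintegral_const_mul_le _ _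
      _ ≤ ∫⁻ t, ((∫⁻ w, pathIntegral 1 (B.indicator 1) (n + p : ℝ≥0) w.1 ∂M.law y) +
            (Set.Ioi p).indicator (fun _ => (n : ℝ≥0∞)) t) ∂a := by
          refine lintegral_mono fun t => ?_
          have hst := isStoppingTime_const M.ℱ t
          have h1 := M.setLIntegral_postPath y hst (F := Set.univ) MeasurableSet.univ (hm n)
          have huniv : Set.univ ∩ {_ω : Ω | (t : WithTop ℝ≥0) < ⊤} = Set.univ := by
            rw [Set.univ_inter]
            exact Set.eq_univ_of_forall fun _ => WithTop.coe_lt_top t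
          rw [huniv, setLIntegral_univ, setLIntegral_univ] at h1
          calc (k : ℝ≥0∞)⁻¹ * M.transition t y A
              ≤ ∫⁻ ω, φ n (M.X t ω) ∂M.P y := by
                have hset : MeasurableSet {ω | M.X t ω ∈ A} := M.measurable_X t hAm
                unfold transition
                rw [← setLIntegral_const]
                exact (setLIntegral_mono' hset fun ω hω => (show _ < φ n (M.X t ω) from hω).le).trans
                  (setLIntegral_le_lintegral _ _)
            _ = ∫⁻ ω, pathIntegral 1 (B.indicator 1) (n : ℝ≥0) (M.postPath t ω).1 ∂M.P y :=
                h1.symm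
            _ ≤ _ := by
              by_cases htp : t ≤ p
              · rw [M.lintegral_law y (hm _)]
                exact le_add_right (lintegral_mono fun ω => pathIntegral_postPath_le hB htp ω)
              · rw [Set.indicator_of_mem (show t ∈ Set.Ioi p from not_le.1 htp)]
                refine le_add_left ((lintegral_mono fun ω => pathIntegral_one_le _ _).trans ?_)
                simp
      _ = _ := by
          rw [lintegral_add_left measurable_const, lintegral_const, measure_univ, mul_one,
            lintegral_indicator measurableSet_Ioi, setLIntegral_const]
  have hvtop : v ≠ ⊤ := by
    refine ne_top_of_le_ne_top ?_ (mul_le_mul_right (min_le_right _ _) _)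
    rw [mul_one]
    intro hk
    have : A = ∅ := by
      rw [hA, hk]; simp
    exact hnk (by rw [this]; exact measure_empty)
  -- the sampling time exceeds a large `p` with small probability
  obtain ⟨p, hp⟩ : ∃ p : ℝ≥0, n * a (Set.Ioi p) ≤ v / 2 := by
    have h1 : Tendsto (fun p : ℝ≥0 => (n : ℝ≥0∞) * a (Set.Ioi p)) atTop (𝓝 (n * 0)) := by
      refine ENNReal.Tendsto.const_mul ?_ (Or.inr (ENNReal.natCast_ne_top n))
      rw [← measure_empty (μ := a), ← show (⋂ p : ℝ≥0, Set.Ioi p) = ∅ from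
        Set.eq_empty_of_forall_notMem fun t ht => lt_irrefl t (Set.mem_iInter.1 ht t)]
      exact tendsto_measure_iInter_atTop (fun _ => measurableSet_Ioi.nullMeasurableSet)
        (fun _ _ h => Set.Ioi_subset_Ioi h) ⟨0, measure_ne_top _ _⟩
    rw [mul_zero] at h1
    exact (h1.eventually (ge_mem_nhds (ENNReal.half_pos hv0))).exists
  set L : ℝ≥0 := n + p
  have hv2 : v / 2 ≠ 0 := (ENNReal.half_pos hv0).ne'
  have hlow : ∀ y ∈ C, v / 2 ≤ ∫⁻ w, pathIntegral 1 (B.indicator 1) L w.1 ∂M.law y :=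
    fun y hy => by
      have h1 := (hle p y hy).trans (add_le_add_right hp _)
      refine (ENNReal.add_le_add_iff_right (ENNReal.div_ne_top hvtop two_ne_zero)).1 ?_
      rwa [ENNReal.add_halves v]
  refine ⟨L, (1 - v / 2 / L).toNNReal, ?_, fun y hy => ?_⟩
  · rw [← ENNReal.coe_lt_coe, ENNReal.coe_toNNReal (by simp)]
    exact ENNReal.sub_lt_self ENNReal.one_ne_top one_ne_zero
      (ENNReal.div_ne_zero.2 ⟨hv2, ENNReal.coe_ne_top⟩)
  · rw [ENNReal.coe_toNNReal (by simp)]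
    have hS : MeasurableSet {w : PathSpace E | pathIntegral 1 (B.indicator 1) L w.1 = 0} :=
      hm L (measurableSet_singleton 0)
    rw [← compl_compl {w : PathSpace E | pathIntegral 1 (B.indicator 1) L w.1 = 0},
      prob_compl_eq_one_sub hS.compl]
    refine tsub_le_tsub_left ?_ _
    refine ENNReal.div_le_of_le_mul ((hlow y hy).trans ?_)
    calc ∫⁻ w, pathIntegral 1 (B.indicator 1) L w.1 ∂M.law y
        ≤ ∫⁻ w, {w : PathSpace E | pathIntegral 1 (B.indicator 1) L w.1 = 0}ᶜ.indicator
          (fun _ => (L : ℝ≥0∞)) w ∂M.law y := by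
          refine lintegral_mono fun w => ?_
          by_cases hw : pathIntegral 1 (B.indicator 1) L w.1 = 0
          · rw [hw]; exact zero_le
          · rw [Set.indicator_of_mem (by exact hw)]
            exact pathIntegral_one_le _ _
      _ = _ := by rw [lintegral_indicator hS.compl, setLIntegral_const, mul_comm]

end StrongMarkovFamily

/-! ### Summing over the cycles before the first visit -/

/-- A sequence that grows at most geometrically, and from some index on contracts by a factor `κ`,
has a sum comparable with its first term. -/
theorem tsum_le_of_eventually_contracting {a : ℕ → ℝ≥0∞} {m κ : ℝ≥0∞} {N : ℕ}
    (hm : ∀ k, a (k + 1) ≤ m * a k) (hκ : ∀ k ≥ N, a (k + 1) ≤ κ * a k) :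
    ∑' k, a k ≤ (∑ k ∈ Finset.range N, m ^ k + m ^ N * (1 - κ)⁻¹) * a 0 := by
  have h1 : ∀ k, a k ≤ m ^ k * a 0 := fun k => by
    induction k with
    | zero => simp
    | succ k ih =>
      refine (hm k).trans ((mul_le_mul_right ih _).trans (le_of_eq ?_))
      ring
  have h2 : ∀ k, a (k + N) ≤ κ ^ k * a N := fun k => by
    induction k with
    | zero => simp
    | succ k ih =>
      rw [Nat.add_right_comm]
      refine (hκ (k + N) le_add_self).trans ((mul_le_mul_right ih _).trans (le_of_eq ?_))
      ring
  have h3 : ∑' k, a (k + N) ≤ m ^ N * (1 - κ)⁻¹ * a 0 :=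
    calc ∑' k, a (k + N) ≤ ∑' k, κ ^ k * a N := ENNReal.tsum_le_tsum h2
      _ = (1 - κ)⁻¹ * a N := by rw [ENNReal.tsum_mul_right, ENNReal.tsum_geometric]
      _ ≤ (1 - κ)⁻¹ * (m ^ N * a 0) := mul_le_mul_right (h1 N) _
      _ = m ^ N * (1 - κ)⁻¹ * a 0 := by rw [← mul_assoc, mul_comm (1 - κ)⁻¹]
  rw [← ENNReal.summable.sum_add_tsum_nat_add' (k := N), add_mul, Finset.sum_mul]
  exact add_le_add (Finset.sum_le_sum fun k _ => h1 k) h3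

/-- The intervals `(s k, s (k + 1)]` cover `(s 0, ∞)`, since each of them has length at least `h`. -/
theorem pathIntegral_le_add_tsum {E : Type*} {V : ℝ≥0 → ℝ≥0∞} {g : E → ℝ≥0∞} {h : ℝ≥0} (hh : 0 < h) {s : ℕ → WithTop ℝ≥0}
    (hs : ∀ k, s k + h ≤ s (k + 1)) (z : WithTop ℝ≥0) (w : ℝ≥0 → E) :
    pathIntegral V g z w ≤ pathIntegral V g (s 0) w +
      ∑' k, {k | s k < z}.indicator (fun k =>
        ∫⁻ u in {u : ℝ≥0 | s k < u ∧ (u : WithTop ℝ≥0) ≤ s (k + 1)}, V u * g (w u)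
          ∂timeMeasure) k := by
  have hgrow : ∀ k : ℕ, ((k * h : ℝ≥0) : WithTop ℝ≥0) ≤ s k := fun k => by
    induction k with
    | zero => rw [Nat.cast_zero, zero_mul]; exact zero_le
    | succ k ih =>
      refine le_trans (le_of_eq ?_) ((add_le_add_left ih _).trans (hs k))
      rw [← WithTop.coe_add]
      push_cast
      rw [add_mul, one_mul]
  let S : ℕ → Set ℝ≥0 := fun k => {u | s k < z ∧ s k < u ∧ (u : WithTop ℝ≥0) ≤ s (k + 1)}
  have hcover : {u : ℝ≥0 | (u : WithTop ℝ≥0) ≤ z} ⊆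
      {u : ℝ≥0 | (u : WithTop ℝ≥0) ≤ s 0} ∪ ⋃ k, S k := by
    intro u hu
    have hex : ∃ k : ℕ, (u : WithTop ℝ≥0) ≤ s k := by
      obtain ⟨k, hk⟩ := exists_nat_ge (u / h)
      exact ⟨k, (WithTop.coe_le_coe.2 ((div_le_iff₀ hh).1 hk)).trans (hgrow k)⟩
    classical
    rcases hk : Nat.find hex with _ | k
    · exact Or.inl (by have := Nat.find_spec hex; rwa [hk] at this)
    · have h1 : s k < u := not_le.1 (Nat.find_min hex (by omega : k < Nat.find hex))
      have h2 := Nat.find_spec hex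
      rw [hk] at h2
      exact Or.inr (Set.mem_iUnion.2 ⟨k, h1.trans_le hu, h1, h2⟩)
  unfold pathIntegral
  refine (lintegral_mono_set hcover).trans ((lintegral_union_le _ _ _).trans ?_)
  refine add_le_add le_rfl ((lintegral_iUnion_le _ _).trans (ENNReal.tsum_le_tsum fun k => ?_))
  by_cases hk : s k < z
  · rw [Set.indicator_of_mem (show k ∈ {k | s k < z} from hk)]
    exact lintegral_mono_set fun u hu => hu.2
  · have : S k = ∅ := Set.eq_empty_of_forall_notMem fun u hu => hk hu.1
    rw [this]
    simp

namespace StrongMarkovFamily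

variable {E Ω : Type*} [MetricSpace E] [MeasurableSpace E] [MeasurableSpace Ω]
  {M : StrongMarkovFamily E Ω} {f : E → ℝ} {r : ℝ≥0 → ℝ} {V : ℝ≥0 → ℝ≥0∞} {c₁ c₂ : ℝ≥0}
  {C : Set E}

/-- If a cycle ends before the first visit to `B`, the path after the start of the cycle does not
spend time in `B` before time `L`. -/
theorem HitsAfter.pathIntegral_postPath_eq_zero {x : E} {B : Set E} {σ σ' ζ : Ω → WithTop ℝ≥0} {a h L : ℝ≥0}
    (hζ : M.HitsAfter x B (fun _ => a) ζ) (hσa : ∀ ω, a ≤ σ ω)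
    (hσ' : ∀ ω, σ ω + h ≤ σ' ω) (hLh : L ≤ h) {ω : Ω} (hω : σ' ω < ζ ω) (htop : σ' ω < ⊤) :
    pathIntegral 1 (B.indicator 1) L (M.postPath (σ ω) ω).1 = 0 := by
  obtain ⟨s, hs⟩ : ∃ s : ℝ≥0, σ ω = s :=
    ⟨_, eq_coe_untopD ((le_self_add.trans (hσ' ω)).trans_lt htop)⟩
  have h1 := hσa ω
  have h2 := hσ' ω
  rw [hs] at h1 h2 ⊢
  unfold pathIntegral
  rw [setLIntegral_congr_fun (g := fun _ => 0) (measurableSet_coe_le _) fun u hu => ?_]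
  · simp
  · have hu' : u ≤ L := WithTop.coe_le_coe.1 hu
    have hmem : M.X (s + u) ω ∉ B := fun hB => by
      refine absurd (hζ.le_of_mem ω (s + u) (h1.trans ?_) hB) (not_le.2 (lt_of_le_of_lt ?_ hω))
      · exact WithTop.coe_le_coe.2 le_self_add
      · refine le_trans ?_ h2
        rw [← WithTop.coe_add]
        exact WithTop.coe_le_coe.2 (add_le_add_right (hu'.trans hLh) _)
    change 1 * B.indicator 1 (M.X (s + u) ω) = 0
    rw [Set.indicator_of_notMem hmem, mul_zero]

variable [BorelSpace E]

theorem exists_seq_hitsAfter (M : StrongMarkovFamily E Ω) (x : E) (hC : IsClosed C) (a h : ℝ≥0) :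
    ∃ σ : ℕ → Ω → WithTop ℝ≥0, M.HitsAfter x C (fun _ => a) (σ 0) ∧
      ∀ k, M.HitsAfter x C (fun ω => σ k ω + h) (σ (k + 1)) := by
  obtain ⟨σ₀, hσ₀⟩ := M.exists_hitsAfter x hC (isStoppingTime_const M.ℱ a)
  choose next hnext using fun σ : {σ : Ω → WithTop ℝ≥0 // IsStoppingTime M.ℱ σ} =>
    M.exists_hitsAfter x hC (isStoppingTime_add_coe σ.2 h)
  let σ : ℕ → {σ : Ω → WithTop ℝ≥0 // IsStoppingTime M.ℱ σ} := fun k =>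
    Nat.rec ⟨σ₀, hσ₀.isStoppingTime⟩ (fun _ s => ⟨next s, (hnext s).isStoppingTime⟩) k
  exact ⟨fun k => (σ k).1, hσ₀, fun k => hnext (σ k)⟩

/-- If from each point of the closed set `C`, the closed set `B` is missed during `[0, L]` with
probability at most `q < 1`, then the modulated moment of the first visit to `B` is at most a
constant times that of `C`. -/
theorem exists_modulatedMoment_le_mul_of_law_le (hf : Measurable f) (hf_one : ∀ x, 1 ≤ f x)
    (hc : IsComparable r V c₁ c₂) (hC : IsClosed C) {B : Set E} (hB : IsClosed B) {L q : ℝ≥0}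
    (hq1 : q < 1) (hq : ∀ y ∈ C, M.law y {w | pathIntegral 1 (B.indicator 1) L w.1 = 0} ≤ q)
    {a h : ℝ≥0} (ha : 0 < a) (hh : 0 < h) (hLh : L ≤ h) {K : ℝ≥0}
    (hK : ∀ y ∈ C, M.modulatedMoment C f r h y ≤ K) :
    ∃ c : ℝ≥0, ∀ x, M.modulatedMoment B f r a x ≤ c * M.modulatedMoment C f r a x := by
  -- constants for which `κ = θ q + η c₁ K < 1`
  obtain ⟨θ, η, hθ1, hη0, hκ⟩ : ∃ θ η : ℝ≥0, 1 < θ ∧ 0 < η ∧ θ * q + η * (c₁ * K) < 1 := by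
    have hcont : ContinuousAt (fun e : ℝ≥0 => (1 + e) * q + e * (c₁ * K)) 0 := by fun_prop
    have h1 : ∀ᶠ e in 𝓝 (0 : ℝ≥0), (1 + e) * q + e * (c₁ * K) < 1 :=
      hcont.eventually (gt_mem_nhds (by simpa using hq1))
    obtain ⟨e, he, he0⟩ := ((h1.filter_mono nhdsWithin_le_nhds).and
      (self_mem_nhdsWithin (s := Set.Ioi (0 : ℝ≥0)))).exists
    exact ⟨1 + e, e, lt_add_of_pos_right _ he0, he0, he⟩
  obtain ⟨T₁, hT₁⟩ := hc.tame.little_o η hη0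
  obtain ⟨S, hS⟩ := hc.tame.slow T₁ θ hθ1
  obtain ⟨ca, hca⟩ := hc.tame.le_integral a ha
  obtain ⟨ch, hch⟩ := hc.tame.le_integral h hh
  obtain ⟨N, hN⟩ := exists_nat_ge (S / h)
  rw [div_le_iff₀ hh] at hN
  set κ : ℝ≥0 := θ * q + η * (c₁ * K) with hκdef
  set m : ℝ≥0 := ch * (c₁ * K) with hmdef
  have hAtop : ∑ k ∈ Finset.range N, (m : ℝ≥0∞) ^ k + m ^ N * (1 - (κ : ℝ≥0∞))⁻¹ ≠ ⊤ := by
    refine ENNReal.add_ne_top.2 ⟨ENNReal.sum_ne_top.2 fun k _ => by finiteness,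
      ENNReal.mul_ne_top (by finiteness) (ENNReal.inv_ne_top.2 ?_)⟩
    exact (tsub_pos_of_lt (by exact_mod_cast hκ)).ne'
  obtain ⟨A', hA'⟩ : ∃ A' : ℝ≥0, (A' : ℝ≥0∞) =
      ∑ k ∈ Finset.range N, (m : ℝ≥0∞) ^ k + m ^ N * (1 - (κ : ℝ≥0∞))⁻¹ :=
    ⟨_, ENNReal.coe_toNNReal hAtop⟩
  refine ⟨1 + c₂ * (c₁ * K * (A' * (ca * c₁))), fun x => ?_⟩
  obtain ⟨σ, hσ0, hσ⟩ := exists_seq_hitsAfter M x hC a h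
  obtain ⟨ζ, hζ⟩ := M.exists_hitsAfter x hB (isStoppingTime_const M.ℱ a)
  have hst : ∀ k, IsStoppingTime M.ℱ (σ k) := fun k => by
    cases k with
    | zero => exact hσ0.isStoppingTime
    | succ k => exact (hσ k).isStoppingTime
  have hmem : ∀ k, ∀ᵐ ω ∂M.P x, ∀ t : ℝ≥0, σ k ω = t → M.X t ω ∈ C := fun k => by
    cases k with
    | zero => exact hσ0.ae_mem
    | succ k => exact (hσ k).ae_mem
  have hgrow : ∀ (k : ℕ) ω, ((a + k * h : ℝ≥0) : WithTop ℝ≥0) ≤ σ k ω := fun k ω => by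
    induction k with
    | zero => simpa using hσ0.le ω
    | succ k ih =>
      refine le_trans (le_of_eq ?_) ((add_le_add_left ih _).trans ((hσ k).le ω))
      rw [← WithTop.coe_add]
      push_cast
      rw [add_mul, one_mul, add_assoc]
  let F : ℕ → Set Ω := fun k => {ω | σ k ω < ζ ω}
  have hF : ∀ k, MeasurableSet[(hst k).measurableSpace] (F k) := fun k => by
    have h1 : F k = {ω | ζ ω ≤ σ k ω}ᶜ := by
      ext ω
      simp [F]
    rw [h1]
    exact (hζ.isStoppingTime.measurableSet_stopping_time_le (hst k)).compl
  have hF' : ∀ k, MeasurableSet (F k) := fun k => (hst k).measurableSpace_le _ (hF k)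
  have hsub : ∀ k, F (k + 1) ⊆ F k := fun k ω hω =>
    (le_self_add.trans ((hσ k).le ω)).trans_lt hω
  have hFtop : ∀ k, F k ∩ {ω | σ k ω < ⊤} = F k := fun k =>
    Set.inter_eq_left.2 fun ω hω =>
    (show σ k ω < ⊤ from (show σ k ω < ζ ω from hω).trans_le le_top)
  have hO : Measurable fun w : PathSpace E => pathIntegral 1 (B.indicator 1) L w.1 :=
    measurable_pathIntegral measurable_one (measurable_one.indicator hB.measurableSet)
      measurable_id measurable_const
  -- the mean weight at the start of the `k`-th cycle, on the event that `B` is not reached before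
  let b : ℕ → ℝ≥0∞ := fun k => ∫⁻ ω in F k ∩ {ω | σ k ω < ⊤}, V ((σ k ω).untopD 0) ∂M.P x
  have hb : ∑' k, b k ≤ A' * b 0 := by
    rw [hA']
    refine tsum_le_of_eventually_contracting (fun k => ?_) fun k hk => ?_
    · rw [hmdef]
      push_cast
      exact HitsAfter.setLIntegral_weight_le hf hf_one hc hC (hst k) (hmem k) (hσ k) hK hch
        (hF k) (hF' (k + 1)) (hsub k)
    · rw [hκdef]
      push_cast
      refine HitsAfter.setLIntegral_weight_le_of_slow hf hf_one hc hC (hst k) (hmem k) (hσ k) hK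
        hT₁ hS (fun ω => ?_) hO hq (hF k) (hF' (k + 1)) (hsub k) fun ω hω htop => ?_
      · refine le_trans (WithTop.coe_le_coe.2 ?_) (hgrow k ω)
        refine hN.trans (le_add_left ?_)
        gcongr
      · exact hζ.pathIntegral_postPath_eq_zero
          (fun ω => (WithTop.coe_le_coe.2 le_self_add).trans (hgrow k ω)) (hσ k).le hLh hω htop
  have hb0 : b 0 ≤ ca * c₁ * M.modulatedMoment C f r a x :=
    (lintegral_mono_set Set.inter_subset_right).trans (hσ0.weight_le hf hf_one hc hca)
  have hm : Measurable fun ω => pathIntegral (fun t => ENNReal.ofReal (r t))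
      (fun z => ENNReal.ofReal (f z)) (σ 0 ω) (fun t => M.X t ω) :=
    measurable_pathIntegral hc.measurable.ennreal_ofReal hf.ennreal_ofReal M.measurable_path
      (hst 0).measurable'
  let seg : ℕ → Ω → ℝ≥0∞ := fun k ω =>
    ∫⁻ u in {u : ℝ≥0 | σ k ω < u ∧ (u : WithTop ℝ≥0) ≤ σ (k + 1) ω},
      ENNReal.ofReal (r u) * ENNReal.ofReal (f (M.X u ω)) ∂timeMeasure
  have hsegm : ∀ k, Measurable fun ω => (F k).indicator (seg k) ω := fun k => by
    exact (measurable_setLIntegral_Ioc hc.measurable.ennreal_ofReal hf.ennreal_ofReal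
      M.measurable_path (hst k).measurable' (hst (k + 1)).measurable').indicator (hF' k)
  calc M.modulatedMoment B f r a x
      ≤ ∫⁻ ω, pathIntegral (fun t => ENNReal.ofReal (r t)) (fun z => ENNReal.ofReal (f z)) (ζ ω)
          (fun t => M.X t ω) ∂M.P x :=
        modulatedMoment_le_of_ae_mem hf hc.measurable hζ.le hζ.ae_mem
    _ ≤ ∫⁻ ω, (pathIntegral (fun t => ENNReal.ofReal (r t)) (fun z => ENNReal.ofReal (f z))
          (σ 0 ω) (fun t => M.X t ω) + ∑' k, (F k).indicator (seg k) ω) ∂M.P x :=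
        lintegral_mono fun ω => pathIntegral_le_add_tsum hh (s := fun k => σ k ω)
          (fun k => (hσ k).le ω) (ζ ω) _
    _ = (∫⁻ ω, pathIntegral (fun t => ENNReal.ofReal (r t)) (fun z => ENNReal.ofReal (f z))
          (σ 0 ω) (fun t => M.X t ω) ∂M.P x) + ∑' k, ∫⁻ ω in F k, seg k ω ∂M.P x := by
        rw [lintegral_add_left hm, lintegral_tsum fun k => (hsegm k).aemeasurable]
        simp_rw [lintegral_indicator (hF' _)]
    _ ≤ M.modulatedMoment C f r a x + ∑' k, c₂ * (c₁ * K * b k) := by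
        refine add_le_add (hσ0.pathIntegral_le hf hc.measurable) (ENNReal.tsum_le_tsum fun k => ?_)
        have h1 := HitsAfter.setLIntegral_segment_le hf hc hC (hst k) (hmem k) (hσ k) hK (hF k)
        refine le_trans (le_of_eq ?_) h1
        rw [hFtop k]
    _ ≤ M.modulatedMoment C f r a x +
          c₂ * (c₁ * K * (A' * (ca * c₁ * M.modulatedMoment C f r a x))) := by
        rw [ENNReal.tsum_mul_left, ENNReal.tsum_mul_left]
        gcongr
        exact hb.trans (mul_le_mul_right hb0 _)
    _ = _ := by
        push_cast
        ring

/-- An accessible set contains a closed set that is occupied from every starting point. -/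
theorem IsAccessible.exists_isClosed {B : Set E} (hB : M.IsAccessible B) :
    ∃ B' ⊆ B, IsClosed B' ∧ ∀ x, 0 < M.occupation x B' := by
  obtain ⟨hBm, ψ, ⟨hψ, -⟩, hψB⟩ := hB
  have := hψ.sigmaFinite
  obtain ⟨D, hDB, hDm, hD0, hDtop⟩ : ∃ D ⊆ B, MeasurableSet D ∧ 0 < ψ D ∧ ψ D < ⊤ := by
    obtain ⟨n, hn⟩ : ∃ n, ψ (B ∩ spanningSets ψ n) ≠ 0 := by
      by_contra! hcon
      refine hψB.ne' ?_
      rw [← Set.inter_univ B, ← iUnion_spanningSets ψ, Set.inter_iUnion]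
      exact measure_iUnion_null hcon
    exact ⟨_, Set.inter_subset_left, hBm.inter (measurableSet_spanningSets ψ n),
      pos_iff_ne_zero.2 hn, (measure_mono Set.inter_subset_right).trans_lt
        (measure_spanningSets_lt_top ψ n)⟩
  have : IsFiniteMeasure (ψ.restrict D) := ⟨by rwa [Measure.restrict_apply_univ]⟩
  obtain ⟨B', hB'D, hB', hpos⟩ := hDm.exists_lt_isClosed_of_ne_top (μ := ψ.restrict D)
    (measure_ne_top _ _) (r := 0) (by rwa [Measure.restrict_apply_self])
  exact ⟨B', hB'D.trans hDB, hB', fun x => hψ.occupation_pos B' hB'.measurableSet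
    (hpos.trans_le (Measure.restrict_apply_le _ _)) x⟩

end StrongMarkovFamily

theorem mainTheorem7 {E Ω : Type*} [MetricSpace E] [LocallyCompactSpace E]
    [TopologicalSpace.SeparableSpace E] [MeasurableSpace E] [BorelSpace E] [MeasurableSpace Ω]
    (M : StrongMarkovFamily E Ω)
    (hψ : ∃ ψ : Measure E, M.IsIrreducibilityMeasure ψ)
    (f : E → ℝ) (hf : Measurable f) (hf_one : ∀ x, 1 ≤ f x)
    (r : ℝ≥0 → ℝ) (hr : IsSubgeometricRate r)
    (hr_loc : ∀ T : ℝ≥0, ∃ a b : ℝ, 0 < a ∧ ∀ t ≤ T, a ≤ r t ∧ r t ≤ b)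
    (C : Set E) (hC_closed : IsClosed C) (hC_petite : M.IsPetite C)
    (δ : ℝ≥0) (hδ : 0 < δ)
    (hC : (⨆ x ∈ C, M.modulatedMoment C f r δ x) < ⊤) :
    (∀ δ' : ℝ≥0, 0 < δ' → (⨆ x ∈ C, M.modulatedMoment C f r δ' x) < ⊤) ∧
    (∀ B : Set E, M.IsAccessible B → ∀ t : ℝ≥0, ∃ c : ℝ≥0, ∀ x : E,
      M.modulatedMoment B f r t x ≤ c * M.modulatedMoment C f r δ x) ∧
    M.IsRegular f r C := by
  obtain ⟨V, c₁, c₂, hc⟩ := hr.exists_isComparable hr_loc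
  have hsup := StrongMarkovFamily.exists_modulatedMoment_iSup_le hf hf_one hc hC_closed hδ hC
  have hmain : ∀ B : Set E, M.IsAccessible B → ∀ t : ℝ≥0, ∃ c : ℝ≥0, ∀ x : E,
      M.modulatedMoment B f r t x ≤ c * M.modulatedMoment C f r δ x := by
    intro B hB t
    obtain ⟨B', hB'B, hB', hocc⟩ := hB.exists_isClosed
    obtain ⟨L, q, hq1, hq⟩ := hC_petite.exists_law_le hB'.measurableSet hocc
    have hK := hsup (L + δ)
    lift (⨆ x ∈ C, M.modulatedMoment C f r (L + δ) x) to ℝ≥0 using hK.ne with K hKeq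
    obtain ⟨c, hcB⟩ := StrongMarkovFamily.exists_modulatedMoment_le_mul_of_law_le hf hf_one hc
      hC_closed hB' hq1 hq (a := t + δ) (h := L + δ) (by positivity) (by positivity) le_self_add
      (K := K) fun y hy => by rw [hKeq]; exact le_iSup₂_of_le y hy le_rfl
    obtain ⟨c', hcC⟩ := StrongMarkovFamily.exists_modulatedMoment_le_mul hf hf_one hc hC_closed hδ
      hC (t + δ)
    refine ⟨c * c', fun x => ?_⟩
    calc M.modulatedMoment B f r t x ≤ M.modulatedMoment B' f r t x := by
          rw [M.modulatedMoment_eq B hf hc.measurable, M.modulatedMoment_eq B' hf hc.measurable]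
          exact lintegral_mono fun ω => pathIntegral_mono (fun _ => le_rfl)
            (hittingAfter_anti M.X t hB'B ω)
      _ ≤ M.modulatedMoment B' f r (t + δ) x :=
          StrongMarkovFamily.modulatedMoment_mono hf hc.measurable le_self_add x
      _ ≤ c * (c' * M.modulatedMoment C f r δ x) := (hcB x).trans (mul_le_mul_right (hcC x) _)
      _ = _ := by rw [ENNReal.coe_mul, mul_assoc]
  refine ⟨fun δ' _ => hsup δ', hmain, hC_petite.1, fun δ' _ B hB => ?_⟩
  obtain ⟨c, hcB⟩ := hmain B hB δ'
  exact (iSup₂_le fun x hx => (hcB x).trans (mul_le_mul_right (le_iSup₂ (f := fun x (_ : x ∈ C) =>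
    M.modulatedMoment C f r δ x) x hx) _)).trans_lt (ENNReal.mul_lt_top ENNReal.coe_lt_top hC)
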